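/- Let $\mathcal A$ be an irreducible supersolvable simplicial arrangement of hyperplanes (i.e. a finite set of linear hyperplanes) in a $3$-dimensional real vector space $V$. Let $L(\mathcal A)$ denote its intersection lattice (all intersections of subsets of $\mathcal A$, ordered by reverse inclusion), and for $X\in L(\mathcal A)$ let $\mathcal A_X=\{H\in\mathcal A\mid X\subseteq H\}$. Call $X\in L(\mathcal A)$ modular if $X+Y\in L(\mathcal A)$ for all $Y\in L(\mathcal A)$. An arrangement in an $\ell$-dimensional space is supersolvable if the intersection of its hyperplanes is $0$ and there is a chain $V=X_0\supsetneq X_1\supsetneq\dots\supsetneq X_\ell=0$ of modular elements of its intersection lattice. A real arrangement is simplicial if every connected component of $V\setminus\bigcup_{H\in\mathcal A}H$ is the set of positive linear combinations of a basis of $V$. It is reducible if $V=V_1\oplus V_2$ with $V_1,V_2\ne0$ and there are arrangements $\mathcal A_1$ in $V_1$ and $\mathcal A_2$ in $V_2$ with $\mathcal A=\{H\oplus V_2\mid H\in\mathcal A_1\}\cup\{V_1\oplus H\mid H\in\mathcal A_2\}$, and irreducible otherwise. Write $\mathcal A\sim_L\mathcal B$ if $L(\mathcal A)\cong L(\mathcal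 B)$. For $n\ge 3$ let $\mathcal A(2n,1)$ be the arrangement in $\mathbb R^3$ of the $2n$ planes orthogonal to the vectors $(-\sin\frac{k\pi}{n},\cos\frac{k\pi}{n},0)$, $0\le k\le n-1$, and $(\cos\frac{(2j-1)\pi}{n},\sin\frac{(2j-1)\pi}{n},1)$, $1\le j\le n$. For $m\ge2$ let $\mathcal A(4m+1,1)=\mathcal A(4m,1)\cup\{(0,0,1)^\perp\}$. Let $X\in L(\mathcal A)$ be a modular element of codimension $2$, and set $n:=|\mathcal A_X|$. Let $\mathcal B\subseteq\mathcal A$ be a subarrangement with $\mathcal B_X=\mathcal A_X$ and $\mathcal B\sim_L\mathcal A(2n,1)$. Then 1. $|\mathcal A\setminus\mathcal B|\le 1$, and 2. if $\mathcal A=\mathcal B\,\dot\cup\,\{J\}$ for some hyperplane $J$, then $n$ is even and $\mathcal A\sim_L\mathcal A(4\tfrac n2+1,1)$. -/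

import Mathlib

/-- A (central) hyperplane arrangement in `V`: a finite set of hyperplanes, that is, of linear
subspaces of codimension one (the coatoms of the lattice of subspaces). -/
structure Arrangement (V : Type*) [AddCommGroup V] [Module ℝ V] where
  hyperplanes : Set (Submodule ℝ V)
  finite_hyperplanes : hyperplanes.Finite
  isCoatom_of_mem : ∀ H ∈ hyperplanes, IsCoatom H

namespace Arrangement

section Lattice

variable {V : Type*} [AddCommGroup V] [Module ℝ V]

/-- The underlying set of the intersection lattice `L(A)`: all intersections of subsets of `A`
(the empty intersection is `V`). -/
def flats (A : Arrangement V) : Set (Submodule ℝ V) :=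
  {X | ∃ S : Set (Submodule ℝ V), S ⊆ A.hyperplanes ∧ X = sInf S}

/-- The intersection lattice `L(A)`, partially ordered by reverse inclusion. -/
abbrev IntersectionLattice (A : Arrangement V) : Type _ := (A.flats)ᵒᵈ

/-- `L_q(A)`: the elements of `L(A)` of rank (codimension) `q`. -/
def flatsOfRank (A : Arrangement V) (q : ℕ) : Set (Submodule ℝ V) :=
  {X | X ∈ A.flats ∧ Module.finrank ℝ (V ⧸ X) = q}

/-- The center `T(A)`: the intersection of all hyperplanes of `A`. -/
def center (A : Arrangement V) : Submodule ℝ V := sInf A.hyperplanes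

/-- `A` is essential if its rank, the codimension of the center, is `dim V`. -/
def IsEssential (A : Arrangement V) : Prop :=
  Module.finrank ℝ (V ⧸ A.center) = Module.finrank ℝ V

/-- The localization `A_X = {H ∈ A | X ⊆ H}`. -/
def localization (A : Arrangement V) (X : Submodule ℝ V) : Arrangement V where
  hyperplanes := {H | H ∈ A.hyperplanes ∧ X ≤ H}
  finite_hyperplanes := A.finite_hyperplanes.subset fun _ h => h.1
  isCoatom_of_mem := fun H h => A.isCoatom_of_mem H h.1

/-- `X ∈ L(A)` is modular if `X + Y ∈ L(A)` for all `Y ∈ L(A)`. -/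
def IsModular (A : Arrangement V) (X : Submodule ℝ V) : Prop :=
  X ∈ A.flats ∧ ∀ Y ∈ A.flats, X ⊔ Y ∈ A.flats

/-- An essential arrangement in an `ℓ`-dimensional space is supersolvable if there is a chain
`V = X₀ < X₁ < ⋯ < X_ℓ = T(A)` of modular elements of `L(A)` (in the order of `L(A)`, which is
reverse inclusion). -/
def IsSupersolvable (A : Arrangement V) : Prop :=
  A.IsEssential ∧
    ∃ X : Fin (Module.finrank ℝ V + 1) → Submodule ℝ V,
      StrictAnti X ∧ X 0 = ⊤ ∧ X (Fin.last _) = A.center ∧ ∀ i, A.IsModular (X i)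

/-- `A` is reducible if it is a product `A₁ × A₂` of arrangements in nonzero spaces, that is, if
`V = V₁ ⊕ V₂` with `V₁, V₂ ≠ 0`, and there are arrangements `A₁` in `V₁` and `A₂` in `V₂` with
`A = {H₁ ⊕ V₂ | H₁ ∈ A₁} ∪ {V₁ ⊕ H₂ | H₂ ∈ A₂}`. -/
def IsReducible (A : Arrangement V) : Prop :=
  ∃ V₁ V₂ : Submodule ℝ V, IsCompl V₁ V₂ ∧ V₁ ≠ ⊥ ∧ V₂ ≠ ⊥ ∧
    ∃ (A₁ : Arrangement V₁) (A₂ : Arrangement V₂),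
      A.hyperplanes =
        (fun H₁ : Submodule ℝ V₁ => H₁.map V₁.subtype ⊔ V₂) '' A₁.hyperplanes ∪
        (fun H₂ : Submodule ℝ V₂ => V₁ ⊔ H₂.map V₂.subtype) '' A₂.hyperplanes

def IsIrreducible (A : Arrangement V) : Prop := ¬ A.IsReducible

/-- Lattice equivalence `A ∼_L B`: the intersection lattices are isomorphic. -/
def LatticeEquiv {W : Type*} [AddCommGroup W] [Module ℝ W]
    (A : Arrangement V) (B : Arrangement W) : Prop :=
  Nonempty (A.IntersectionLattice ≃o B.IntersectionLattice)

end Lattice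

section Chambers

variable {V : Type*} [NormedAddCommGroup V] [NormedSpace ℝ V]

/-- The complement `V \ ⋃_{H ∈ A} H`. -/
def complement (A : Arrangement V) : Set V := {v | ∀ H ∈ A.hyperplanes, v ∉ H}

/-- The chambers of `A`: the connected components of its complement. -/
def chambers (A : Arrangement V) : Set (Set V) :=
  {K | ∃ v ∈ A.complement, K = connectedComponentIn A.complement v}

/-- An open simplicial cone: the set of all positive linear combinations of a basis of `V`. -/
def IsOpenSimplicialCone (K : Set V) : Prop :=
  ∃ b : Module.Basis (Fin (Module.finrank ℝ V)) ℝ V, K = {v | ∀ i, 0 < b.repr v i}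

/-- `A` is simplicial if every chamber is an open simplicial cone. -/
def IsSimplicial (A : Arrangement V) : Prop :=
  ∀ K ∈ A.chambers, IsOpenSimplicialCone K

end Chambers

section Series

/-- The hyperplane `a^⊥ = {x | a₀ x₀ + a₁ x₁ + a₂ x₂ = 0}` in `ℝ³`. -/
def perp (a : Fin 3 → ℝ) : Submodule ℝ (Fin 3 → ℝ) :=
  LinearMap.ker (Fintype.linearCombination ℝ a)

theorem mem_perp (a x : Fin 3 → ℝ) : x ∈ perp a ↔ a 0 * x 0 + a 1 * x 1 + a 2 * x 2 = 0 := by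
  simp [perp, Fintype.linearCombination_apply, Fin.sum_univ_three, mul_comm]

theorem isCoatom_perp (a : Fin 3 → ℝ) (ha : a ≠ 0) : IsCoatom (perp a) := by
  apply LinearMap.isCoatom_ker_of_surjective
  apply LinearMap.surjective
  intro h
  apply ha
  funext i
  have := LinearMap.congr_fun h (Pi.single i 1)
  simpa [Fintype.linearCombination_apply, Pi.single_apply] using this

/-- `c_n(m) = cos (2πm / 2n)`. -/
noncomputable def cosN (n m : ℕ) : ℝ := Real.cos (2 * Real.pi * m / (2 * n))

/-- `s_n(m) = sin (2πm / 2n)`. -/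
noncomputable def sinN (n m : ℕ) : ℝ := Real.sin (2 * Real.pi * m / (2 * n))

/-- The arrangement `A(2n,1)` in `ℝ³` (used for `n ≥ 3`): the hyperplanes
`(-s_n(k), c_n(k), 0)^⊥` for `k = 0, …, n-1` and `(c_n(m), s_n(m), 1)^⊥` for
`m = 1, 3, …, 2n-1`. -/
noncomputable def A2n (n : ℕ) : Arrangement (Fin 3 → ℝ) where
  hyperplanes :=
    Set.range (fun k : Fin n => perp ![-sinN n k, cosN n k, 0]) ∪
    Set.range (fun j : Fin n => perp ![cosN n (2 * j + 1), sinN n (2 * j + 1), 1])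
  finite_hyperplanes := (Set.finite_range _).union (Set.finite_range _)
  isCoatom_of_mem := by
    rintro H (⟨k, rfl⟩ | ⟨j, rfl⟩)
    · apply isCoatom_perp
      intro h
      have h0 : sinN n k = 0 := by simpa using congrFun h 0
      have h1 : cosN n k = 0 := by simpa using congrFun h 1
      have := Real.sin_sq_add_cos_sq (2 * Real.pi * (k : ℕ) / (2 * n))
      rw [sinN] at h0
      rw [cosN] at h1
      rw [h0, h1] at this
      norm_num at this
    · apply isCoatom_perp
      intro h
      simpa using congrFun h 2

/-- The arrangement `A(4m+1,1) = A(4m,1) ∪ {(0,0,1)^⊥}` in `ℝ³` (used for `m ≥ 2`). -/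
noncomputable def A4mAddOne (m : ℕ) : Arrangement (Fin 3 → ℝ) where
  hyperplanes := insert (perp ![0, 0, 1]) (A2n (2 * m)).hyperplanes
  finite_hyperplanes := (A2n (2 * m)).finite_hyperplanes.insert _
  isCoatom_of_mem := by
    rintro H (rfl | hH)
    · apply isCoatom_perp
      intro h
      simpa using congrFun h 2
    · exact (A2n (2 * m)).isCoatom_of_mem H hH

end Series

end Arrangement

/-!
Working in the dual space, the hyperplanes not containing `X` become points of the affine plane
`{h | h x = 1}` for a fixed nonzero `x ∈ X`, and those containing `X` become directions. The lattice
of `A(2n,1)` labels the points of `B` by `ℤ/n` so that the chord joining `p i` and `p j` has a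
direction depending only on `i + j`. Such a polygon is affinely regular: its edge vectors satisfy a
recurrence `a (i + 2) = k • a (i + 1) - a i`, and periodicity forces `k ^ 2 < 4`. This gives
coordinates in which `B` is `A(2n,1)`.

By modularity of `X`, a further hyperplane of `A` is a point `w` whose lines to all the vertices
have chord directions. The line from `w` through the vertex `p i` has the direction of a chord from
`p i` to some `p (σ i)`, or of the tangent at `p i` if `σ i = i`, and `σ` is a permutation.
Reflecting `w` in these directions and summing over `i` shows that `w` is the center and
`p (σ i) = -p i` relative to it, so `n` is even.
-/

section RegularPolygon

open Function

variable {E : Type*} [AddCommGroup E] [Module ℝ E] {n : ℕ}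

theorem zmod_two_ne_zero (hn : 3 ≤ n) : (2 : ZMod n) ≠ 0 := by
  rw [← Nat.cast_ofNat, Ne, ZMod.natCast_eq_zero_iff]
  exact fun h => absurd (Nat.le_of_dvd two_pos h) (by lia)

theorem apply_eq_apply_zero_of_periodic_one {α : Type*} {f : ZMod n → α} (hf : Periodic f 1)
    (i : ZMod n) : f i = f 0 := by
  simpa using hf.int_mul_eq i.cast

section Recurrence

variable [NeZero n] {k : ℝ}

theorem sum_sub_mul_sq_of_recurrence {u : ZMod n → ℝ} {ε : ℝ} (hε : ε ^ 2 = 1)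
    (hu : ∀ i, u (i + 2) = k * u (i + 1) - u i) :
    ∑ i, (u (i + 1) - ε * u i) ^ 2 = (2 - ε * k) * ∑ i, u i ^ 2 := by
  have sum_shift (f : ZMod n → ℝ) : ∑ i, f (i + 1) = ∑ i, f i :=
    Equiv.sum_comp (Equiv.addRight 1) f
  have hsq : ∑ i, u (i + 1) ^ 2 = ∑ i, u i ^ 2 := sum_shift fun i => u i ^ 2
  have hprod : ∑ i, u (i + 2) * u (i + 1) = ∑ i, u (i + 1) * u i := by
    simpa only [add_assoc, one_add_one_eq_two] using sum_shift fun i => u (i + 1) * u i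
  have htwo : 2 * ∑ i, u (i + 1) * u i = k * ∑ i, u i ^ 2 := calc
    2 * ∑ i, u (i + 1) * u i = ∑ i, (u (i + 2) * u (i + 1) + u (i + 1) * u i) := by
      rw [Finset.sum_add_distrib, hprod, two_mul]
    _ = ∑ i, k * u (i + 1) ^ 2 := Finset.sum_congr rfl fun i _ => by rw [hu]; ring
    _ = k * ∑ i, u i ^ 2 := by rw [← Finset.mul_sum, hsq]
  calc ∑ i, (u (i + 1) - ε * u i) ^ 2
      = ∑ i, (u (i + 1) ^ 2 - 2 * ε * (u (i + 1) * u i) + u i ^ 2) :=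
        Finset.sum_congr rfl fun i _ => by linear_combination u i ^ 2 * hε
    _ = (2 - ε * k) * ∑ i, u i ^ 2 := by
      rw [Finset.sum_add_distrib, Finset.sum_sub_distrib, ← Finset.mul_sum, hsq]
      linear_combination -ε * htwo

theorem sq_lt_four_of_recurrence {a : ZMod n → E} (ha : ∀ i, a (i + 2) = k • a (i + 1) - a i)
    (hind : LinearIndependent ℝ ![a 0, a 1]) : k ^ 2 < 4 := by
  by_contra! hk
  obtain ⟨ε, hε, hεk⟩ : ∃ ε : ℝ, ε ^ 2 = 1 ∧ 2 ≤ ε * k := by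
    rcases abs_cases k with ⟨h, -⟩ | ⟨h, -⟩
    · exact ⟨1, by norm_num, by nlinarith [abs_nonneg k]⟩
    · exact ⟨-1, by norm_num, by nlinarith [abs_nonneg k]⟩
  have hgeom : a 1 - ε • a 0 = 0 := by
    refine (Module.forall_dual_apply_eq_zero_iff ℝ _).1 fun f => ?_
    have hsum := sum_sub_mul_sq_of_recurrence (k := k) (u := fun i => f (a i)) hε
      fun i => by simp [ha]
    have hnonpos : ∑ i, (f (a (i + 1)) - ε * f (a i)) ^ 2 ≤ 0 := hsum.trans_le <|
      mul_nonpos_of_nonpos_of_nonneg (by linarith) (Finset.sum_nonneg fun i _ => sq_nonneg _)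
    have hzero := (Finset.sum_eq_zero_iff_of_nonneg fun i _ => sq_nonneg _).1
      (hnonpos.antisymm (Finset.sum_nonneg fun i _ => sq_nonneg _)) 0 (Finset.mem_univ _)
    simpa using hzero
  have := LinearIndependent.pair_iff.1 hind (-ε) 1 (by rw [← hgeom]; module)
  exact one_ne_zero this.2

theorem exists_injective_linearMap_apply_one_apply {z : ℂ} (hz : z.im ≠ 0) {u v : E}
    (huv : LinearIndependent ℝ ![u, v]) :
    ∃ G : ℂ →ₗ[ℝ] E, Injective G ∧ G 1 = u ∧ G z = v := by
  have hbasis : LinearIndependent ℝ ![1, z] := by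
    refine LinearIndependent.pair_iff.2 fun s t hst => ?_
    have ht : t = 0 := by simpa [hz] using congrArg Complex.im hst
    exact ⟨by simpa [ht] using congrArg Complex.re hst, ht⟩
  let b := basisOfLinearIndependentOfCardEqFinrank hbasis (by simp)
  have hb : ⇑b = ![1, z] := coe_basisOfLinearIndependentOfCardEqFinrank _ _
  refine ⟨Finsupp.linearCombination ℝ ![u, v] ∘ₗ b.repr, ?_, ?_, ?_⟩
  · exact Injective.comp (g := Finsupp.linearCombination ℝ ![u, v]) huv b.repr.injective
  · simpa [hb] using congrArg (Finsupp.linearCombination ℝ ![u, v]) (b.repr_self 0)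
  · simpa [hb] using congrArg (Finsupp.linearCombination ℝ ![u, v]) (b.repr_self 1)

theorem exists_addChar_of_recurrence {a : ZMod n → E}
    (ha : ∀ i, a (i + 2) = k • a (i + 1) - a i) (hind : LinearIndependent ℝ ![a 0, a 1]) :
    ∃ (ψ : AddChar (ZMod n) ℂ) (G : ℂ →ₗ[ℝ] E),
      ψ 1 ≠ 1 ∧ Injective G ∧ ∀ i, a i = G (ψ i) := by
  have hk : 0 < 4 - k ^ 2 := by linarith [sq_lt_four_of_recurrence ha hind]
  -- a root of the characteristic polynomial of the recurrence
  let z : ℂ := ⟨k / 2, √(4 - k ^ 2) / 2⟩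
  have hz : z ^ 2 = k * z - 1 := by
    have hsqrt := Real.mul_self_sqrt hk.le
    apply Complex.ext <;> simp only [z, pow_two] at hsqrt ⊢ <;> simp <;> linarith
  have hzim : z.im ≠ 0 := (half_pos (Real.sqrt_pos.2 hk)).ne'
  obtain ⟨G, hG, hG0, hG1⟩ := exists_injective_linearMap_apply_one_apply hzim hind
  have hpow (m : ℕ) : a m = G (z ^ m) ∧ a (m + 1) = G (z ^ (m + 1)) := by
    induction m with
    | zero => simp [hG0, hG1]
    | succ m ih =>
      have hzm : z ^ (m + 2) = k • z ^ (m + 1) - z ^ m := by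
        rw [Complex.real_smul]
        linear_combination z ^ m * hz
      refine ⟨by exact_mod_cast ih.2, ?_⟩
      rw [hzm, map_sub, map_smul, ← ih.1, ← ih.2, ← ha]
      push_cast
      ring_nf
  have hzn : z ^ n = 1 := hG <| by rw [← (hpow n).1, ZMod.natCast_self, hG0]
  refine ⟨AddChar.zmodChar n hzn, G, ?_, hG, fun i => ?_⟩
  · intro h
    have hz1 : z = 1 := by
      rw [← h, ← Nat.cast_one, AddChar.zmodChar_apply', pow_one]
    exact hzim (by rw [hz1, Complex.one_im])
  · rw [AddChar.zmodChar_apply, ← (hpow i.val).1, ZMod.natCast_zmod_val]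

end Recurrence

theorem exists_eq_add_of_sub_eq {p : ZMod n → E} {ψ : AddChar (ZMod n) ℂ} (hψ : ψ 1 ≠ 1)
    {G : ℂ →ₗ[ℝ] E} (hp : ∀ i, p (i + 1) - p i = G (ψ i)) :
    ∃ c : E, ∀ i, p i = c + G ((ψ 1 - 1)⁻¹ * ψ i) := by
  have hψ' : ψ 1 - 1 ≠ 0 := sub_ne_zero.2 hψ
  have hper : Periodic (fun i => p i - G ((ψ 1 - 1)⁻¹ * ψ i)) 1 := fun i => by
    have hmul : (ψ 1 - 1)⁻¹ * ψ (i + 1) = (ψ 1 - 1)⁻¹ * ψ i + ψ i := by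
      rw [AddChar.map_add_eq_mul]
      field_simp
      ring
    simp only [hmul, map_add, ← hp]
    abel
  exact ⟨_, fun i => sub_eq_iff_eq_add.1 (apply_eq_apply_zero_of_periodic_one hper i)⟩

section Parallel

variable {p : ZMod n → E}
  (hpar : ∀ i j k l, k ≠ l → i + j = k + l → ∃ t : ℝ, p i - p j = t • (p k - p l))
  (hind : ∀ i, LinearIndependent ℝ ![p (i + 1) - p i, p (i + 2) - p (i + 1)])

include hpar hind

theorem exists_recurrence_of_parallel (hn : 3 ≤ n) :
    ∃ k : ℝ, ∀ i, p (i + 3) - p (i + 2) = k • (p (i + 2) - p (i + 1)) - (p (i + 1) - p i) := by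
  have : Fact (1 < n) := ⟨by lia⟩
  have hlocal (i : ZMod n) : ∃ k : ℝ,
      p (i + 3) - p (i + 2) = k • (p (i + 2) - p (i + 1)) - (p (i + 1) - p i) := by
    obtain ⟨t, ht⟩ := hpar (i + 3) i (i + 2) (i + 1)
      (fun h => one_ne_zero (α := ZMod n) (by linear_combination h)) (by ring)
    exact ⟨t - 1, by linear_combination (norm := module) ht⟩
  choose k hk using hlocal
  have hper : Periodic k 1 := fun i => by
    obtain ⟨t, ht⟩ := hpar (i + 4) i (i + 3) (i + 1)
      (fun h => zmod_two_ne_zero hn (by linear_combination h)) (by ring)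
    have hk' := hk (i + 1)
    have hind' := hind (i + 1)
    simp only [add_assoc, one_add_one_eq_two, show (1 + 2 : ZMod n) = 3 by norm_num,
      show (1 + 3 : ZMod n) = 4 by norm_num] at hk' hind'
    have hcoeff := LinearIndependent.pair_iff.1 hind' (k i - t) (k (i + 1) - t)
      (by linear_combination (norm := module) -hk i - hk' + ht)
    linarith [hcoeff.1, hcoeff.2]
  exact ⟨k 0, fun i => apply_eq_apply_zero_of_periodic_one hper i ▸ hk i⟩

theorem exists_addChar_of_parallel (hn : 3 ≤ n) (hinj : Injective p) :
    ∃ (ψ : AddChar (ZMod n) ℂ) (c : E) (G : ℂ →ₗ[ℝ] E),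
      Injective ψ ∧ Injective G ∧ ∀ i, p i = c + G (ψ i) := by
  have : NeZero n := ⟨by lia⟩
  obtain ⟨k, hk⟩ := exists_recurrence_of_parallel hpar hind hn
  obtain ⟨ψ, G, hψ1, hG, hdiff⟩ := exists_addChar_of_recurrence (k := k)
    (a := fun i => p (i + 1) - p i)
    (fun i => by
      rw [show i + 2 + 1 = i + 3 by ring, show i + 1 + 1 = i + 2 by ring]
      exact hk i)
    (by simpa [one_add_one_eq_two] using hind 0)
  obtain ⟨c, hc⟩ := exists_eq_add_of_sub_eq hψ1 hdiff
  refine ⟨ψ, c, G ∘ₗ LinearMap.mulLeft ℝ (ψ 1 - 1)⁻¹, fun i j hij => hinj ?_, ?_, hc⟩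
  · rw [hc, hc, hij]
  · exact hG.comp (mul_right_injective₀ (inv_ne_zero (sub_ne_zero.2 hψ1)))

end Parallel

section Center

theorem eq_neg_of_sum_add_eq_zero {ι F : Type*} [Fintype ι] [NormedAddCommGroup F]
    [InnerProductSpace ℝ F] {w : F} {u : ι → F} (hu : ∀ i, ‖u i‖ ≤ ‖w‖)
    (hsum : ∑ i, (w + u i) = 0) (i : ι) : u i = -w := by
  have hsq (i : ι) : ‖w + u i‖ ^ 2 ≤ 2 * inner ℝ w (w + u i) := by
    rw [norm_add_sq_real, inner_add_right, real_inner_self_eq_norm_sq]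
    linarith [pow_le_pow_left₀ (norm_nonneg _) (hu i) 2]
  have hle : ∑ i, ‖w + u i‖ ^ 2 ≤ 0 := calc
    ∑ i, ‖w + u i‖ ^ 2 ≤ ∑ i, 2 * inner ℝ w (w + u i) := Finset.sum_le_sum fun i _ => hsq i
    _ = 0 := by rw [← Finset.mul_sum, ← inner_sum, hsum, inner_zero_right, mul_zero]
  have hzero := (Finset.sum_eq_zero_iff_of_nonneg fun i _ => sq_nonneg ‖w + u i‖).1
    (hle.antisymm (Finset.sum_nonneg fun i _ => sq_nonneg _)) i (Finset.mem_univ i)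
  exact eq_neg_of_add_eq_zero_right (norm_eq_zero.1 (sq_eq_zero_iff.1 hzero))

theorem even_of_addChar_eq_neg_one {ψ : AddChar (ZMod n) ℂ} {i : ZMod n} (hi : ψ i = -1) :
    Even n := by
  have hpow : (-1 : ℂ) ^ n = 1 := by rw [← hi, ← AddChar.map_nsmul_eq_pow]; simp
  by_contra hodd
  rw [(Nat.not_even_iff_odd.1 hodd).neg_one_pow] at hpow
  norm_num at hpow

variable [NeZero n] {ψ : AddChar (ZMod n) ℂ} {w : ℂ}

open ComplexConjugate

/-- `z ↦ ψ (i + i') * conj z` is, up to sign, the reflection in the directions of the chords whose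
labels add up to `i + i'`. -/
theorem add_mul_conj_eq_of_sub_eq {i i' j k : ZMod n} {t : ℝ} (hjk : j + k = i + i')
    (hw : w - ψ i = t * (ψ j - ψ k)) : w + ψ (i + i') * conj w = ψ i + ψ i' := by
  have hψ (l : ZMod n) : conj (ψ l) * ψ l = 1 := by
    rw [← AddChar.map_neg_eq_conj, ← AddChar.map_add_eq_mul, neg_add_cancel,
      AddChar.map_zero_eq_one]
  have hconj := congrArg conj hw
  simp only [map_sub, map_mul, Complex.conj_ofReal] at hconj
  have hi' : ψ (i + i') = ψ i * ψ i' := AddChar.map_add_eq_mul ψ i i'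
  have hjk' : ψ (i + i') = ψ j * ψ k := by rw [← hjk, AddChar.map_add_eq_mul]
  linear_combination hw + ψ (i + i') * hconj + conj (ψ i) * hi' + ψ i' * hψ i
    + t * (conj (ψ j) - conj (ψ k)) * hjk' + t * ψ k * hψ j - t * ψ j * hψ k

theorem eq_zero_and_even_of_perm (hn : 3 ≤ n) (hψ : Injective ψ) {σ : Equiv.Perm (ZMod n)}
    (hσ : ∀ i, w + ψ (i + σ i) * conj w = ψ i + ψ (σ i)) : w = 0 ∧ Even n := by
  have hψ2 : ψ 2 ≠ 1 := fun h =>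
    zmod_two_ne_zero hn (hψ (h.trans (AddChar.map_zero_eq_one ψ).symm))
  have hψ1 : ψ ≠ 1 := fun h => hψ2 (by rw [h, AddChar.one_apply])
  have hsum : ∑ i, (w + ψ (i + σ i) * conj w) = 0 := by
    simp only [hσ, Finset.sum_add_distrib, Equiv.sum_comp σ ψ,
      AddChar.sum_eq_zero_of_ne_one hψ1, add_zero]
  have hneg := eq_neg_of_sum_add_eq_zero (fun i => by simp [AddChar.norm_apply]) hsum
  have hψσ (i : ZMod n) : ψ (σ i) = -ψ i :=
    eq_neg_of_add_eq_zero_right (by rw [← hσ, hneg, add_neg_cancel])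
  have hw (i : ZMod n) : w = ψ (i + i) * conj w := by
    have := hneg i
    rw [AddChar.map_add_eq_mul, hψσ] at this
    rw [AddChar.map_add_eq_mul]
    linear_combination this
  constructor
  · have hreal : w = conj w := by simpa using hw 0
    have hfix : w = ψ 2 * w := by simpa only [one_add_one_eq_two, ← hreal] using hw 1
    exact (mul_left_eq_self₀.1 hfix.symm).resolve_left hψ2
  · exact even_of_addChar_eq_neg_one ((hψσ 0).trans (by simp))

end Center

end RegularPolygon

section ModularLattice

variable {α : Type*} [Lattice α] [BoundedOrder α]

theorem isCompl_of_isAtom_of_isCoatom {a b : α} (ha : IsAtom a) (hb : IsCoatom b) (hab : ¬a ≤ b) :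
    IsCompl a b :=
  ⟨ha.not_le_iff_disjoint.1 hab, (hb.not_le_iff_codisjoint.1 hab).symm⟩

variable [IsModularLattice α] {a b c : α}

theorem inf_covBy_left_of_isCoatom (ha : IsCoatom a) (hb : IsCoatom b) (hab : a ≠ b) :
    a ⊓ b ⋖ a :=
  inf_covBy_of_covBy_sup_right <| by rw [ha.sup_eq_top_of_ne hb hab]; exact hb.covBy_top

theorem isCoatom_sup_inf_of_isCompl {x : α} (ha : IsCoatom a) (hb : IsCoatom b) (hab : a ≠ b)
    (hx : IsCompl x a) : IsCoatom (x ⊔ a ⊓ b) := by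
  have hsup : (x ⊔ a ⊓ b) ⊔ a = ⊤ := by
    rw [sup_assoc, sup_eq_right.2 (inf_le_left : a ⊓ b ≤ a), hx.sup_eq_top]
  have hinf : (x ⊔ a ⊓ b) ⊓ a = a ⊓ b := by
    rw [sup_comm, sup_inf_assoc_of_le _ inf_le_left, hx.inf_eq_bot, sup_bot_eq]
  have hcov : (x ⊔ a ⊓ b) ⊓ a ⋖ a := by
    rw [hinf]
    exact inf_covBy_left_of_isCoatom ha hb hab
  rw [← covBy_top_iff, ← hsup]
  exact covBy_sup_of_inf_covBy_right hcov

theorem inf_eq_inf_of_inf_le (ha : IsCoatom a) (hb : IsCoatom b) (hc : IsCoatom c)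
    (hab : a ≠ b) (hac : a ≠ c) (h : a ⊓ b ≤ c) : a ⊓ b = a ⊓ c :=
  (((inf_covBy_left_of_isCoatom ha hb hab).eq_or_eq (le_inf inf_le_left h)
    inf_le_left).resolve_right fun hle => hac ((ha.le_iff_eq hc.1).1 (inf_eq_left.1 hle)).symm).symm

theorem inf_le_of_inf_le_of_inf_le {d : α} (ha : IsCoatom a) (hb : IsCoatom b) (hc : IsCoatom c)
    (hd : IsCoatom d) (hab : a ≠ b) (had : a ≠ d) (hbc : b ≠ c) (hbd : b ≠ d) (h : a ⊓ d ≤ b)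
    (h' : b ⊓ c ≤ d) : a ⊓ d ≤ c := by
  have hab' : a ⊓ b = a ⊓ d := (inf_eq_inf_of_inf_le ha hd hb had hab h).symm
  calc a ⊓ d = b ⊓ a := by rw [← hab', inf_comm]
    _ = b ⊓ d := inf_eq_inf_of_inf_le hb ha hd hab.symm hbd (by
      rw [inf_comm, hab']
      exact inf_le_right)
    _ = b ⊓ c := (inf_eq_inf_of_inf_le hb hc hd hbc hbd h').symm
    _ ≤ c := inf_le_right

theorem isCompl_inf_of_isCompl_inf (ha : IsCoatom a) (hba : ¬b ≤ a) (h : IsCompl (a ⊓ b) c) :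
    IsCompl a (c ⊓ b) := by
  refine ⟨disjoint_iff_inf_le.2 ?_, (ha.not_le_iff_codisjoint.1 fun hle => hba ?_)⟩
  · rw [← h.inf_eq_bot]
    exact le_inf (le_inf inf_le_left (inf_le_right.trans inf_le_right))
      (inf_le_right.trans inf_le_left)
  · calc b = (a ⊓ b ⊔ c) ⊓ b := by rw [h.sup_eq_top, top_inf_eq]
      _ = a ⊓ b ⊔ c ⊓ b := sup_inf_assoc_of_le c inf_le_right
      _ ≤ a := sup_le inf_le_left hle

end ModularLattice

namespace Arrangement

section Flats

variable {V : Type*} [AddCommGroup V] [Module ℝ V] {W : Type*} [AddCommGroup W] [Module ℝ W]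
  {A : Arrangement V} {B : Arrangement W}

theorem mem_flats_of_mem_hyperplanes {H : Submodule ℝ V} (hH : H ∈ A.hyperplanes) : H ∈ A.flats :=
  ⟨{H}, Set.singleton_subset_iff.2 hH, sInf_singleton.symm⟩

theorem top_mem_flats : ⊤ ∈ A.flats := ⟨∅, Set.empty_subset _, sInf_empty.symm⟩

theorem inf_mem_flats {Y Z : Submodule ℝ V} (hY : Y ∈ A.flats) (hZ : Z ∈ A.flats) :
    Y ⊓ Z ∈ A.flats := by
  obtain ⟨S, hS, rfl⟩ := hY
  obtain ⟨T, hT, rfl⟩ := hZ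
  exact ⟨S ∪ T, Set.union_subset hS hT, sInf_union.symm⟩

instance : SemilatticeInf A.flats := Subtype.semilatticeInf fun _ _ => inf_mem_flats

instance : OrderTop A.flats := Subtype.orderTop top_mem_flats

instance : OrderBot A.flats where
  bot := ⟨A.center, A.hyperplanes, subset_rfl, rfl⟩
  bot_le := fun ⟨_, _, hS, hY⟩ => (sInf_le_sInf hS).trans_eq hY.symm

theorem localization_bot : (A.localization (⊥ : A.flats)).hyperplanes = A.hyperplanes :=
  Set.ext fun _ => and_iff_left_of_imp fun hH => sInf_le hH

theorem sInf_localization {Y : Submodule ℝ V} (hY : Y ∈ A.flats) :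
    sInf (A.localization Y).hyperplanes = Y := by
  refine le_antisymm ?_ (le_sInf fun H hH => hH.2)
  obtain ⟨S, hS, rfl⟩ := hY
  exact sInf_le_sInf fun H hH => ⟨hS hH, sInf_le hH⟩

theorem exists_mem_hyperplanes_ge {Y : Submodule ℝ V} (hY : Y ∈ A.flats) (hne : Y ≠ ⊤) :
    ∃ H ∈ A.hyperplanes, Y ≤ H := by
  contrapose! hne
  rw [← sInf_localization hY, sInf_eq_top]
  exact fun H hH => absurd hH.2 (hne H hH.1)

theorem mem_hyperplanes_of_isCoatom {Y : Submodule ℝ V} (hY : Y ∈ A.flats) (hc : IsCoatom Y) :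
    Y ∈ A.hyperplanes := by
  obtain ⟨H, hH, hle⟩ := exists_mem_hyperplanes_ge hY hc.1
  rwa [← (hc.le_iff_eq (A.isCoatom_of_mem H hH).1).1 hle]

theorem isCoatom_iff_mem_hyperplanes {Y : A.flats} : IsCoatom Y ↔ ↑Y ∈ A.hyperplanes := by
  constructor <;> intro hY
  · obtain ⟨H, hH, hle⟩ := exists_mem_hyperplanes_ge Y.2 fun h => hY.1 (Subtype.ext h)
    let H' : A.flats := ⟨H, mem_flats_of_mem_hyperplanes hH⟩
    have hH' : H' ≠ ⊤ := fun h => (A.isCoatom_of_mem H hH).1 (congrArg Subtype.val h)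
    rwa [← (hY.le_iff_eq hH').1 (show Y ≤ H' from hle)]
  · have hc := A.isCoatom_of_mem Y hY
    exact ⟨fun h => hc.1 (congrArg Subtype.val h), fun Z hZ => Subtype.ext (hc.2 Z hZ)⟩

theorem LatticeEquiv.nonempty_flats_orderIso (h : A.LatticeEquiv B) :
    Nonempty (A.flats ≃o B.flats) :=
  h.map OrderIso.dual

section OrderIso

variable (e : A.flats ≃o B.flats)

theorem apply_mem_hyperplanes_iff {Y : A.flats} :
    (e Y : Submodule ℝ W) ∈ B.hyperplanes ↔ ↑Y ∈ A.hyperplanes := by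
  rw [← isCoatom_iff_mem_hyperplanes, ← isCoatom_iff_mem_hyperplanes, e.isCoatom_iff]

theorem ncard_localization_apply (Y : A.flats) :
    (B.localization (e Y)).hyperplanes.ncard = (A.localization Y).hyperplanes.ncard := by
  symm
  refine Set.ncard_congr (fun H hH => e ⟨H, mem_flats_of_mem_hyperplanes hH.1⟩)
    (fun H hH => ⟨(apply_mem_hyperplanes_iff e).2 hH.1, e.monotone hH.2⟩)
    (fun H K _ _ h => congrArg Subtype.val (e.injective (Subtype.ext h))) fun K hK => ?_
  let K' : B.flats := ⟨K, mem_flats_of_mem_hyperplanes hK.1⟩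
  exact ⟨e.symm K', ⟨(apply_mem_hyperplanes_iff e.symm).2 hK.1, e.le_symm_apply.2 hK.2⟩,
    congrArg Subtype.val (e.apply_symm_apply K')⟩

include e in
theorem ncard_hyperplanes_eq : B.hyperplanes.ncard = A.hyperplanes.ncard := by
  simpa only [map_bot, localization_bot] using ncard_localization_apply e ⊥

end OrderIso

theorem latticeEquiv_of_linearEquiv (φ : V ≃ₗ[ℝ] W)
    (h : A.hyperplanes = Submodule.comap (φ : V →ₗ[ℝ] W) '' B.hyperplanes) : A.LatticeEquiv B := by
  let o : Submodule ℝ V ≃o Submodule ℝ W := Submodule.orderIsoMapComap φ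
  have hAB : o.symm '' B.hyperplanes = A.hyperplanes := h.symm
  have hBA : o '' A.hyperplanes = B.hyperplanes := by
    rw [← hAB, Set.image_image]
    simp only [OrderIso.apply_symm_apply, Set.image_id']
  have hflats (Y : Submodule ℝ V) : Y ∈ A.flats ↔ o Y ∈ B.flats := by
    constructor
    · rintro ⟨S, hS, rfl⟩
      exact ⟨o '' S, hBA ▸ Set.image_mono hS, by rw [sInf_image, ← o.map_sInf]⟩
    · rintro ⟨S, hS, hY⟩
      refine ⟨o.symm '' S, hAB ▸ Set.image_mono hS, ?_⟩
      rw [sInf_image, ← o.symm.map_sInf, ← hY, o.symm_apply_apply]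
  let e : A.flats ≃o B.flats :=
    { toEquiv := o.toEquiv.subtypeEquiv hflats
      map_rel_iff' := o.le_iff_le }
  exact ⟨e.dual⟩

end Flats

section Modular

variable {V : Type*} [AddCommGroup V] [Module ℝ V] {A B : Arrangement V}
  {X H K M N : Submodule ℝ V}

theorem IsModular.of_localization_eq (hmod : A.IsModular X)
    (hBA : B.hyperplanes ⊆ A.hyperplanes) (hBX : A.localization X = B.localization X) :
    B.IsModular X := by
  have hflats {Y : Submodule ℝ V} (hY : Y ∈ A.flats) (hle : X ≤ Y) : Y ∈ B.flats := by
    refine ⟨(A.localization Y).hyperplanes, fun H hH => ?_, (sInf_localization hY).symm⟩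
    have hHX : H ∈ (A.localization X).hyperplanes := ⟨hH.1, hle.trans hH.2⟩
    rw [hBX] at hHX
    exact hHX.1
  refine ⟨hflats hmod.1 le_rfl, fun Y ⟨S, hS, hY⟩ => ?_⟩
  exact hflats (hmod.2 Y ⟨S, hS.trans hBA, hY⟩) le_sup_left

theorem IsModular.sup_inf_mem_localization (hmod : A.IsModular X) (hX : IsAtom X)
    (hH : H ∈ A.hyperplanes) (hK : K ∈ A.hyperplanes) (hHK : H ≠ K) (hXH : ¬X ≤ H) :
    X ⊔ H ⊓ K ∈ (A.localization X).hyperplanes := by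
  have hHc := A.isCoatom_of_mem H hH
  refine ⟨mem_hyperplanes_of_isCoatom (hmod.2 _ ?_) ?_, le_sup_left⟩
  · exact inf_mem_flats (mem_flats_of_mem_hyperplanes hH) (mem_flats_of_mem_hyperplanes hK)
  · exact isCoatom_sup_inf_of_isCompl hHc (A.isCoatom_of_mem K hK) hHK
      (isCompl_of_isAtom_of_isCoatom hX hHc hXH)

theorem isReducible_of_isCompl {P : Submodule ℝ V} (hMP : IsCompl M P) (hM0 : M ≠ ⊥)
    (hM : M ∈ A.hyperplanes) (hP : ∀ H ∈ A.hyperplanes, H ≠ M → P ≤ H) : A.IsReducible := by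
  have hMc := A.isCoatom_of_mem M hM
  have hP0 : P ≠ ⊥ := fun h => hMc.1 (eq_top_of_isCompl_bot (h ▸ hMP))
  have hcomap {Q H : Submodule ℝ V} (hH : IsCoatom H) (hQ : ¬Q ≤ H) :
      IsCoatom (H.comap Q.subtype) :=
    (Submodule.isCoatom_comap_or_eq_top _ hH).resolve_right fun h =>
      hQ (Submodule.comap_subtype_eq_top.1 h)
  have hmapM {H : Submodule ℝ V} (hH : H ∈ A.hyperplanes) (hne : H ≠ M) :
      (H.comap M.subtype).map M.subtype ⊔ P = H := by
    rw [Submodule.map_comap_subtype, inf_comm, inf_sup_assoc_of_le M (hP H hH hne),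
      hMP.sup_eq_top, inf_top_eq]
  have hmapP : M ⊔ (M.comap P.subtype).map P.subtype = M := by
    rw [Submodule.map_comap_subtype, inf_comm, hMP.inf_eq_bot, sup_bot_eq]
  refine ⟨M, P, hMP, hM0, hP0,
    ⟨(fun H => H.comap M.subtype) '' (A.hyperplanes \ {M}),
      A.finite_hyperplanes.sdiff.image _, ?_⟩,
    ⟨{M.comap P.subtype}, Set.finite_singleton _, ?_⟩, ?_⟩
  · rintro _ ⟨H, ⟨hH, hne⟩, rfl⟩
    have hHc := A.isCoatom_of_mem H hH
    exact hcomap hHc fun hle => hne ((hMc.le_iff_eq hHc.1).1 hle)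
  · rintro _ rfl
    exact hcomap hMc fun hle => hP0 (hMP.disjoint.eq_bot_of_ge hle)
  · rw [Set.image_image, Set.image_singleton, hmapP,
      Set.image_congr fun H hH => hmapM hH.1 hH.2, Set.image_id', Set.sdiff_union_self,
      Set.union_eq_left.2 (Set.singleton_subset_iff.2 hM)]

theorem isReducible_of_forall_inf_le (hX : IsAtom X) (hXA : X ∈ A.flats) (hMN : M ≠ N)
    (hloc : (A.localization X).hyperplanes = {M, N}) (hXH : IsCompl X H)
    (hH : ∀ K ∈ A.hyperplanes, ¬X ≤ K → H ⊓ N ≤ K) : A.IsReducible := by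
  obtain ⟨hM, hXM⟩ : M ∈ (A.localization X).hyperplanes := hloc ▸ Set.mem_insert M {N}
  obtain ⟨hN, -⟩ : N ∈ (A.localization X).hyperplanes := hloc ▸ Set.mem_insert_of_mem M rfl
  have hMc := A.isCoatom_of_mem M hM
  have hX_eq : M ⊓ N = X := by rw [← sInf_pair, ← hloc, sInf_localization hXA]
  have hcompl : IsCompl M (H ⊓ N) := by
    refine isCompl_inf_of_isCompl_inf hMc (fun hle => hMN ?_) (hX_eq.symm ▸ hXH)
    exact ((A.isCoatom_of_mem N hN).le_iff_eq hMc.1).1 hle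
  refine isReducible_of_isCompl hcompl (fun h => hX.1 (le_bot_iff.1 (h ▸ hXM))) hM
    fun K hK hKM => ?_
  by_cases hXK : X ≤ K
  · have hK' : K ∈ (A.localization X).hyperplanes := ⟨hK, hXK⟩
    rw [hloc] at hK'
    exact hK'.resolve_left hKM ▸ inf_le_right
  · exact hH K hK hXK

theorem IsModular.forall_inf_le_or_forall_inf_le (hmod : A.IsModular X) (hX : IsAtom X)
    (hloc : (A.localization X).hyperplanes = {M, N}) (hH : H ∈ A.hyperplanes) (hXH : ¬X ≤ H) :
    (∀ K ∈ A.hyperplanes, ¬X ≤ K → H ⊓ M ≤ K) ∨ ∀ K ∈ A.hyperplanes, ¬X ≤ K → H ⊓ N ≤ K := by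
  have hc {K : Submodule ℝ V} (hK : K ∈ A.hyperplanes) : IsCoatom K := A.isCoatom_of_mem K hK
  have ne {K Q : Submodule ℝ V} (hXK : ¬X ≤ K) (hXQ : X ≤ Q) : K ≠ Q := fun h => hXK (h ▸ hXQ)
  obtain ⟨hM, hXM⟩ : M ∈ (A.localization X).hyperplanes := hloc ▸ Set.mem_insert M {N}
  obtain ⟨hN, hXN⟩ : N ∈ (A.localization X).hyperplanes := hloc ▸ Set.mem_insert_of_mem M rfl
  have inf_le_or {H K : Submodule ℝ V} (hH : H ∈ A.hyperplanes) (hK : K ∈ A.hyperplanes)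
      (hHK : H ≠ K) (hXH : ¬X ≤ H) : H ⊓ K ≤ M ∨ H ⊓ K ≤ N := by
    have hmem := hmod.sup_inf_mem_localization hX hH hK hHK hXH
    rw [hloc] at hmem
    exact hmem.imp (le_sup_right.trans_eq ·) (le_sup_right.trans_eq ·)
  have flip {K Q : Submodule ℝ V} (hK : K ∈ A.hyperplanes) (hQ : Q ∈ A.hyperplanes) (hXQ : X ≤ Q)
      (hHK : H ≠ K) (hle : H ⊓ K ≤ Q) : H ⊓ Q ≤ K :=
    (inf_eq_inf_of_inf_le (hc hH) (hc hK) (hc hQ) hHK (ne hXH hXQ) hle).ge.trans inf_le_right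
  by_contra! h
  obtain ⟨⟨L, hL, hXL, hLM⟩, K, hK, hXK, hKN⟩ := h
  have hHK : H ≠ K := fun h => hKN (h ▸ inf_le_left)
  have hHL : H ≠ L := fun h => hLM (h ▸ inf_le_left)
  have hKM : H ⊓ M ≤ K := flip hK hM hXM hHK <|
    (inf_le_or hH hK hHK hXH).resolve_right fun h => hKN (flip hK hN hXN hHK h)
  have hLN : H ⊓ N ≤ L := flip hL hN hXN hHL <|
    (inf_le_or hH hL hHL hXH).resolve_left fun h => hLM (flip hL hM hXM hHL h)
  have hKL : K ≠ L := fun h => hLM (h ▸ hKM)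
  rcases inf_le_or hK hL hKL hXK with h | h
  · exact hLM (inf_le_of_inf_le_of_inf_le (hc hH) (hc hK) (hc hL) (hc hM) hHK (ne hXH hXM) hKL
      (ne hXK hXM) hKM h)
  · exact hKN (inf_le_of_inf_le_of_inf_le (hc hH) (hc hL) (hc hK) (hc hN) hHL (ne hXH hXN)
      hKL.symm (ne hXL hXN) hLN (inf_comm K L ▸ h))

theorem IsModular.isReducible_of_localization_eq_pair (hmod : A.IsModular X) (hX : IsAtom X)
    (hMN : M ≠ N) (hloc : (A.localization X).hyperplanes = {M, N}) : A.IsReducible := by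
  by_cases hall : ∀ H ∈ A.hyperplanes, X ≤ H
  · obtain ⟨H, hXH⟩ := exists_isCompl X
    exact isReducible_of_forall_inf_le hX hmod.1 hMN hloc hXH fun K hK hXK =>
      absurd (hall K hK) hXK
  · push Not at hall
    obtain ⟨H, hH, hXH⟩ := hall
    have hcompl := isCompl_of_isAtom_of_isCoatom hX (A.isCoatom_of_mem H hH) hXH
    rcases hmod.forall_inf_le_or_forall_inf_le hX hloc hH hXH with h | h
    · exact isReducible_of_forall_inf_le hX hmod.1 hMN.symm
        (hloc.trans (Set.pair_comm M N)) hcompl h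
    · exact isReducible_of_forall_inf_le hX hmod.1 hMN hloc hcompl h

theorem one_lt_ncard_localization (hX : X ∈ A.flats) (hne : X ≠ ⊤) (hc : ¬IsCoatom X) :
    1 < (A.localization X).hyperplanes.ncard := by
  obtain ⟨H, hH, hXH⟩ := exists_mem_hyperplanes_ge hX hne
  have := (A.localization X).finite_hyperplanes.to_subtype
  refine Set.one_lt_ncard_iff_nontrivial.2 <| Set.not_subsingleton_iff.1 fun hsub => hc ?_
  rw [← sInf_localization hX, hsub.eq_singleton_of_mem ⟨hH, hXH⟩, sInf_singleton]
  exact A.isCoatom_of_mem H hH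

theorem IsModular.three_le_ncard_localization (hirr : A.IsIrreducible) (hmod : A.IsModular X)
    (hX : IsAtom X) (hne : X ≠ ⊤) (hc : ¬IsCoatom X) :
    3 ≤ (A.localization X).hyperplanes.ncard := by
  refine Nat.lt_of_le_of_ne (one_lt_ncard_localization hmod.1 hne hc) fun htwo => hirr ?_
  obtain ⟨M, N, hMN, hloc⟩ := Set.ncard_eq_two.1 htwo.symm
  exact hmod.isReducible_of_localization_eq_pair hX hMN hloc

theorem isAtom_and_not_isCoatom_of_finrank_quotient_eq_two (hV : Module.finrank ℝ V = 3)
    (hX : Module.finrank ℝ (V ⧸ X) = 2) : IsAtom X ∧ X ≠ ⊤ ∧ ¬IsCoatom X := by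
  have : Module.Finite ℝ V := Module.finite_of_finrank_pos (by lia)
  have hadd := X.finrank_quotient_add_finrank
  refine ⟨Submodule.isAtom_iff_finrank_eq_one.2 (by lia), ?_, fun hc => ?_⟩
  · rintro rfl
    rw [finrank_top] at hadd
    lia
  · have := isSimpleModule_iff_finrank_eq_one.1 (isSimpleModule_iff_isCoatom.2 hc)
    lia

end Modular

section ChordLabelling

variable {V : Type*} [AddCommGroup V] [Module ℝ V] {W : Type*} [AddCommGroup W] [Module ℝ W]
  {A : Arrangement V} {B : Arrangement W} {X : Submodule ℝ V} {n : ℕ}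

/-- A labelling by `ℤ/n` of the hyperplanes of `A`, `mirror s` being those through `X` and `side i`
the others, such that `side i ∩ side j` lies on `mirror (i + j)`. For `A(2n,1)` the sides are dual
to the vertices of a regular `n`-gon and `mirror s` is dual to the common direction of the chords
joining the vertices `i` and `j` with `i + j = s`. -/
structure ChordLabelling (A : Arrangement V) (X : Submodule ℝ V) (n : ℕ) where
  mirror : ZMod n → Submodule ℝ V
  side : ZMod n → Submodule ℝ V
  mirror_injective : Function.Injective mirror
  le_mirror : ∀ s, X ≤ mirror s
  not_le_side : ∀ i, ¬X ≤ side i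
  hyperplanes_eq : A.hyperplanes = Set.range mirror ∪ Set.range side
  side_inf_side_le : ∀ i j, i ≠ j → side i ⊓ side j ≤ mirror (i + j)

namespace ChordLabelling

variable (L : ChordLabelling A X n)

theorem mirror_mem (s : ZMod n) : L.mirror s ∈ A.hyperplanes :=
  L.hyperplanes_eq ▸ Or.inl (Set.mem_range_self s)

theorem side_mem (i : ZMod n) : L.side i ∈ A.hyperplanes :=
  L.hyperplanes_eq ▸ Or.inr (Set.mem_range_self i)

theorem isCoatom_mirror (s : ZMod n) : IsCoatom (L.mirror s) :=
  A.isCoatom_of_mem _ (L.mirror_mem s)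

theorem isCoatom_side (i : ZMod n) : IsCoatom (L.side i) :=
  A.isCoatom_of_mem _ (L.side_mem i)

theorem range_mirror : Set.range L.mirror = (A.localization X).hyperplanes := by
  refine Set.Subset.antisymm ?_ fun H hH => ?_
  · rintro _ ⟨s, rfl⟩
    exact ⟨L.mirror_mem s, L.le_mirror s⟩
  · have hHA : H ∈ Set.range L.mirror ∪ Set.range L.side := L.hyperplanes_eq ▸ hH.1
    refine hHA.resolve_right ?_
    rintro ⟨i, rfl⟩
    exact L.not_le_side i hH.2

theorem side_injective : Function.Injective L.side := fun i j hij => by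
  by_contra hne
  have hle : L.side i ≤ L.mirror (i + j) := by
    simpa only [← hij, inf_idem] using L.side_inf_side_le i j hne
  have heq := ((L.isCoatom_side i).le_iff_eq (L.isCoatom_mirror _).1).1 hle
  exact L.not_le_side i (heq ▸ L.le_mirror _)

include L in
theorem ncard_localization : (A.localization X).hyperplanes.ncard = n := by
  rw [← L.range_mirror, Set.ncard_range_of_injective L.mirror_injective, Nat.card_zmod]

include L in
theorem ncard_hyperplanes [NeZero n] : A.hyperplanes.ncard = 2 * n := by
  have hdisj : Disjoint (Set.range L.mirror) (Set.range L.side) := by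
    rw [Set.disjoint_left]
    rintro _ ⟨s, rfl⟩ ⟨i, hi⟩
    exact L.not_le_side i (hi ▸ L.le_mirror s)
  rw [L.hyperplanes_eq, Set.ncard_union_eq hdisj, Set.ncard_range_of_injective L.mirror_injective,
    Set.ncard_range_of_injective L.side_injective, Nat.card_zmod, two_mul]

theorem le_of_three_lt_ncard [NeZero n]
    (hL : ∀ s t, s ≠ t → L.mirror s ⊓ L.mirror t ≤ X) {Y : Submodule ℝ V}
    (hY : 3 < (A.localization Y).hyperplanes.ncard) : Y ≤ X := by
  contrapose! hY
  have hmirror : {s | Y ≤ L.mirror s}.ncard ≤ 1 := by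
    refine (Set.ncard_le_one_iff (Set.toFinite _)).2 fun {s t} hs ht => ?_
    by_contra hst
    exact hY ((le_inf hs ht).trans (hL s t hst))
  have hside : {i | Y ≤ L.side i}.ncard ≤ 2 := by
    by_contra! hthree
    obtain ⟨i, j, k, hi, hj, hk, hij, hik, hjk⟩ := (Set.two_lt_ncard_iff (Set.toFinite _)).1 hthree
    have hYs := (le_inf hi hj).trans (L.side_inf_side_le i j hij)
    have hYt := (le_inf hi hk).trans (L.side_inf_side_le i k hik)
    exact hY ((le_inf hYs hYt).trans (hL _ _ fun h => hjk (add_left_cancel h)))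
  have hloc : (A.localization Y).hyperplanes ⊆
      L.mirror '' {s | Y ≤ L.mirror s} ∪ L.side '' {i | Y ≤ L.side i} := by
    rintro H ⟨hH, hYH⟩
    rw [L.hyperplanes_eq] at hH
    rcases hH with ⟨s, rfl⟩ | ⟨i, rfl⟩
    · exact Or.inl ⟨s, hYH, rfl⟩
    · exact Or.inr ⟨i, hYH, rfl⟩
  calc (A.localization Y).hyperplanes.ncard
      ≤ (L.mirror '' {s | Y ≤ L.mirror s}).ncard + (L.side '' {i | Y ≤ L.side i}).ncard :=
        (Set.ncard_le_ncard hloc).trans (Set.ncard_union_le _ _)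
    _ ≤ 1 + 2 := add_le_add ((Set.ncard_image_le (Set.toFinite _)).trans hmirror)
        ((Set.ncard_image_le (Set.toFinite _)).trans hside)

/-- The labelling pulled back along an isomorphism of intersection lattices. -/
def comap {X : A.flats} (e : A.flats ≃o B.flats) (L : ChordLabelling B (e X) n) :
    ChordLabelling A X n where
  mirror s := e.symm ⟨L.mirror s, mem_flats_of_mem_hyperplanes (L.mirror_mem s)⟩
  side i := e.symm ⟨L.side i, mem_flats_of_mem_hyperplanes (L.side_mem i)⟩
  mirror_injective := fun s t h => L.mirror_injective <|
    congrArg Subtype.val (e.symm.injective (Subtype.ext h))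
  le_mirror s := e.le_symm_apply.2 (L.le_mirror s)
  not_le_side i h := L.not_le_side i (e.le_symm_apply.1 h)
  hyperplanes_eq := by
    refine Set.Subset.antisymm (fun H hH => ?_) ?_
    · let H' : A.flats := ⟨H, mem_flats_of_mem_hyperplanes hH⟩
      have heH : ↑(e H') ∈ B.hyperplanes := (apply_mem_hyperplanes_iff e).2 hH
      rw [L.hyperplanes_eq] at heH
      have symm_apply {K : Submodule ℝ W} (hK : K ∈ B.flats) (h : K = e H') :
          (e.symm ⟨K, hK⟩ : Submodule ℝ V) = H :=
        congrArg Subtype.val ((e.symm_apply_eq (y := ⟨K, hK⟩)).2 (Subtype.ext h) : _ = H')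
      exact heH.imp (fun ⟨s, hs⟩ => ⟨s, symm_apply _ hs⟩) fun ⟨i, hi⟩ => ⟨i, symm_apply _ hi⟩
    · rintro _ (⟨s, rfl⟩ | ⟨i, rfl⟩)
      · exact (apply_mem_hyperplanes_iff e.symm).2 (L.mirror_mem s)
      · exact (apply_mem_hyperplanes_iff e.symm).2 (L.side_mem i)
  side_inf_side_le i j hij := by
    have h := e.symm.monotone (show (⟨L.side i, mem_flats_of_mem_hyperplanes (L.side_mem i)⟩ ⊓
      ⟨L.side j, mem_flats_of_mem_hyperplanes (L.side_mem j)⟩ : B.flats) ≤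
      ⟨L.mirror (i + j), mem_flats_of_mem_hyperplanes (L.mirror_mem _)⟩ from
        L.side_inf_side_le i j hij)
    rwa [map_inf] at h

end ChordLabelling

end ChordLabelling

section Series

open ComplexConjugate

variable {n : ℕ}

/-- The primitive `2n`-th root of unity `exp (2πi / 2n)`, whose powers are the unit vectors
`(cosN n m, sinN n m)`. -/
noncomputable def halfRoot (n : ℕ) : ℂ := Complex.exp (2 * Real.pi * Complex.I / (2 * n : ℕ))

theorem halfRoot_pow (n m : ℕ) : halfRoot n ^ m = ⟨cosN n m, sinN n m⟩ := by
  rw [halfRoot, ← Complex.exp_nat_mul, cosN, sinN]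
  have hexp : (m : ℂ) * (2 * Real.pi * Complex.I / (2 * n : ℕ)) =
      (2 * Real.pi * m / (2 * n) : ℝ) * Complex.I := by
    push_cast
    ring
  rw [hexp]
  exact Complex.ext (Complex.exp_ofReal_mul_I_re _) (Complex.exp_ofReal_mul_I_im _)

theorem halfRoot_ne_zero (n : ℕ) : halfRoot n ≠ 0 := Complex.exp_ne_zero _

theorem conj_halfRoot_mul_self (n m : ℕ) : conj (halfRoot n ^ m) * halfRoot n ^ m = 1 := by
  rw [Complex.conj_mul', halfRoot_pow, ← Complex.ofReal_pow, Complex.sq_norm, Complex.normSq_mk,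
    cosN, sinN, ← sq, ← sq, Real.cos_sq_add_sin_sq, Complex.ofReal_one]

theorem halfRoot_pow_two_mul [NeZero n] (k : ℕ) :
    halfRoot n ^ (2 * k) = ZMod.stdAddChar (k : ZMod n) := by
  have h := ZMod.stdAddChar_coe (N := n) k
  rw [Int.cast_natCast, Int.cast_natCast] at h
  rw [h, halfRoot, ← Complex.exp_nat_mul]
  congr 1
  push_cast
  have := NeZero.ne (n : ℂ)
  field_simp

theorem halfRoot_pow_two_mul_add_one [NeZero n] (k : ℕ) :
    halfRoot n ^ (2 * k + 1) = halfRoot n * ZMod.stdAddChar (k : ZMod n) := by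
  rw [pow_succ', halfRoot_pow_two_mul]

/-- The orthogonal projection of `ℝ³` to the plane `v 2 = 0`, identified with `ℂ`. -/
noncomputable def planar : (Fin 3 → ℝ) →ₗ[ℝ] ℂ where
  toFun v := ⟨v 0, v 1⟩
  map_add' _ _ := rfl
  map_smul' _ _ := by apply Complex.ext <;> simp

theorem mem_perp_mirror_iff [NeZero n] {k : ℕ} {v : Fin 3 → ℝ} :
    v ∈ perp ![-sinN n k, cosN n k, 0] ↔
      planar v = ZMod.stdAddChar (k : ZMod n) * conj (planar v) := by
  have him : v ∈ perp ![-sinN n k, cosN n k, 0] ↔ (conj (halfRoot n ^ k) * planar v).im = 0 := by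
    simp [mem_perp, halfRoot_pow, planar, add_comm]
  have hunit := conj_halfRoot_mul_self n k
  rw [him, ← Complex.conj_eq_iff_im, ← halfRoot_pow_two_mul, two_mul, pow_add, map_mul,
    Complex.conj_conj]
  constructor <;> intro h
  · linear_combination -planar v * hunit - halfRoot n ^ k * h
  · linear_combination -conj (halfRoot n ^ k) * h - halfRoot n ^ k * conj (planar v) * hunit

theorem mem_perp_side_iff {m : ℕ} {v : Fin 3 → ℝ} :
    v ∈ perp ![cosN n m, sinN n m, 1] ↔
      planar v + (halfRoot n ^ m) ^ 2 * conj (planar v) + 2 * v 2 * halfRoot n ^ m = 0 := by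
  have hre : v ∈ perp ![cosN n m, sinN n m, 1] ↔
      (conj (halfRoot n ^ m) * planar v + v 2).re = 0 := by
    simp [mem_perp, halfRoot_pow, planar]
  have hunit := conj_halfRoot_mul_self n m
  rw [hre, ← Complex.ofReal_eq_zero, Complex.re_eq_add_conj, div_eq_zero_iff,
    or_iff_left two_ne_zero]
  simp only [map_add, map_mul, Complex.conj_conj, Complex.conj_ofReal]
  constructor <;> intro h
  · linear_combination halfRoot n ^ m * h - planar v * hunit
  · linear_combination conj (halfRoot n ^ m) * h -
      (halfRoot n ^ m * conj (planar v) + 2 * v 2) * hunit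

/-- The common axis of the planes `(-s_n(k), c_n(k), 0)^⊥`. -/
noncomputable def axis : Submodule ℝ (Fin 3 → ℝ) := LinearMap.ker planar

theorem isAtom_axis : IsAtom axis := by
  have hspan : axis = Submodule.span ℝ {Pi.single 2 1} := by
    ext v
    rw [axis, LinearMap.mem_ker, Submodule.mem_span_singleton]
    constructor
    · intro h
      refine ⟨v 2, funext fun i => ?_⟩
      have h0 : v 0 = 0 := congrArg Complex.re h
      have h1 : v 1 = 0 := congrArg Complex.im h
      fin_cases i <;> simp [h0, h1]
    · rintro ⟨t, rfl⟩
      apply Complex.ext <;> simp [planar]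
  rw [hspan]
  exact nonzero_span_atom _ (by simp)

theorem exists_mem_perp_mirror_notMem_axis (k : ℕ) :
    ∃ v ∈ perp ![-sinN n k, cosN n k, 0], v ∉ axis := by
  refine ⟨![cosN n k, sinN n k, 0], ?_, fun h => ?_⟩
  · rw [mem_perp]
    simp [mul_comm]
  · exact pow_ne_zero k (halfRoot_ne_zero n) ((halfRoot_pow n k).trans h)

variable [NeZero n]

theorem perp_mirror_inf_perp_mirror_le_axis {k l : ℕ} (hkl : (k : ZMod n) ≠ l) :
    perp ![-sinN n k, cosN n k, 0] ⊓ perp ![-sinN n l, cosN n l, 0] ≤ axis := by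
  rintro v ⟨hk, hl⟩
  have h := (mem_perp_mirror_iff.1 hk).symm.trans (mem_perp_mirror_iff.1 hl)
  have hzero := (mul_eq_mul_right_iff.1 h).resolve_left fun h => hkl (ZMod.injective_stdAddChar h)
  exact (map_eq_zero _).1 hzero

theorem planar_eq_mul_of_root {q a b t : ℂ} (hab : a ≠ b)
    (ha : q + a ^ 2 * conj q + 2 * t * a = 0) (hb : q + b ^ 2 * conj q + 2 * t * b = 0) :
    q = a * b * conj q := by
  have hsum : (a + b) * conj q + 2 * t = 0 := by
    apply mul_left_cancel₀ (sub_ne_zero.2 hab)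
    linear_combination ha - hb
  linear_combination ha - a * hsum

theorem perp_side_inf_perp_side_le {i j : ZMod n} (hij : i ≠ j) :
    perp ![cosN n (2 * i.val + 1), sinN n (2 * i.val + 1), 1] ⊓
      perp ![cosN n (2 * j.val + 1), sinN n (2 * j.val + 1), 1] ≤
        perp ![-sinN n (i + j + 1).val, cosN n (i + j + 1).val, 0] := by
  rintro v ⟨hi, hj⟩
  rw [SetLike.mem_coe, mem_perp_side_iff, halfRoot_pow_two_mul_add_one, ZMod.natCast_zmod_val]
    at hi hj
  have hne : halfRoot n * ZMod.stdAddChar i ≠ halfRoot n * ZMod.stdAddChar j := fun h =>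
    hij (ZMod.injective_stdAddChar (mul_left_cancel₀ (halfRoot_ne_zero n) h))
  have hone : halfRoot n ^ 2 = ZMod.stdAddChar (1 : ZMod n) := by
    simpa using halfRoot_pow_two_mul (n := n) 1
  rw [mem_perp_mirror_iff, ZMod.natCast_zmod_val, AddChar.map_add_eq_mul, AddChar.map_add_eq_mul,
    ← hone]
  refine (planar_eq_mul_of_root hne hi hj).trans ?_
  ring

theorem axis_le_perp_mirror (k : ℕ) : axis ≤ perp ![-sinN n k, cosN n k, 0] := fun v hv => by
  rw [mem_perp_mirror_iff, LinearMap.mem_ker.1 hv, map_zero, mul_zero]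

/-- The labelling of `A(2n,1)` in which `mirror s` is `(-s_n(s+1), c_n(s+1), 0)^⊥` and `side i` is
`(c_n(2i+1), s_n(2i+1), 1)^⊥`. -/
noncomputable def labellingA2n (n : ℕ) [NeZero n] : ChordLabelling (A2n n) axis n where
  mirror s := perp ![-sinN n (s + 1).val, cosN n (s + 1).val, 0]
  side i := perp ![cosN n (2 * i.val + 1), sinN n (2 * i.val + 1), 1]
  mirror_injective s t h := by
    by_contra hst
    obtain ⟨v, hv, hvaxis⟩ := exists_mem_perp_mirror_notMem_axis (n := n) (s + 1).val
    refine hvaxis (perp_mirror_inf_perp_mirror_le_axis ?_ ⟨hv, h.le hv⟩)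
    simpa using hst
  le_mirror s := axis_le_perp_mirror _
  not_le_side i h := by
    have hmem : Pi.single 2 1 ∈ axis := Complex.ext (by simp [planar]) (by simp [planar])
    simpa [mem_perp] using h hmem
  hyperplanes_eq := by
    have hval : Function.Surjective fun i : ZMod n => (⟨i.val, i.val_lt⟩ : Fin n) := fun k =>
      ⟨k, Fin.ext (ZMod.val_cast_of_lt k.2)⟩
    have hval' := hval.comp (Equiv.addRight (1 : ZMod n)).surjective
    exact congrArg₂ (· ∪ ·) (hval'.range_comp _).symm (hval.range_comp _).symm
  side_inf_side_le i j hij := perp_side_inf_perp_side_le hij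

theorem labellingA2n_mirror_inf_mirror_le {s t : ZMod n} (hst : s ≠ t) :
    (labellingA2n n).mirror s ⊓ (labellingA2n n).mirror t ≤ axis :=
  perp_mirror_inf_perp_mirror_le_axis (by simpa using hst)

theorem axis_mem_flats (hn : 2 ≤ n) : axis ∈ (A2n n).flats := by
  have : Fact (1 < n) := ⟨hn⟩
  let L := labellingA2n n
  have haxis : L.mirror 0 ⊓ L.mirror 1 = axis :=
    (labellingA2n_mirror_inf_mirror_le zero_ne_one).antisymm
      (le_inf (L.le_mirror 0) (L.le_mirror 1))
  rw [← haxis]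
  exact inf_mem_flats (mem_flats_of_mem_hyperplanes (L.mirror_mem 0))
    (mem_flats_of_mem_hyperplanes (L.mirror_mem 1))

end Series

section Existence

variable {V : Type*} [AddCommGroup V] [Module ℝ V] {W : Type*} [AddCommGroup W] [Module ℝ W]
  {A : Arrangement V} {B : Arrangement W} {X : Submodule ℝ V} {n : ℕ}

theorem eq_of_le_of_ncard_localization_le {Y Z : Submodule ℝ V} (hY : Y ∈ A.flats)
    (hZ : Z ∈ A.flats) (hle : Y ≤ Z)
    (hcard : (A.localization Y).hyperplanes.ncard ≤ (A.localization Z).hyperplanes.ncard) :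
    Y = Z := by
  have hloc : (A.localization Z).hyperplanes = (A.localization Y).hyperplanes :=
    Set.eq_of_subset_of_ncard_le (fun H hH => ⟨hH.1, hle.trans hH.2⟩) hcard
      (A.localization Y).finite_hyperplanes
  rw [← sInf_localization hY, ← sInf_localization hZ, hloc]

theorem ChordLabelling.nonempty_of_orderIso [NeZero n] {Z : Submodule ℝ W}
    (L : ChordLabelling B Z n) (hL : ∀ s t, s ≠ t → L.mirror s ⊓ L.mirror t ≤ Z)
    (hZ : Z ∈ B.flats) (e : A.flats ≃o B.flats) (hX : X ∈ A.flats)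
    (hcard : (A.localization X).hyperplanes.ncard = n) (hn : 3 < n) :
    Nonempty (ChordLabelling A X n) := by
  let X' : A.flats := ⟨X, hX⟩
  have hcard' : (B.localization (e X')).hyperplanes.ncard = n :=
    (ncard_localization_apply e X').trans hcard
  have heX : (e X' : Submodule ℝ W) = Z := eq_of_le_of_ncard_localization_le (e X').2 hZ
    (L.le_of_three_lt_ncard hL (hn.trans_eq hcard'.symm))
    (hcard'.trans L.ncard_localization.symm).le
  exact ⟨ChordLabelling.comap (X := X') e (heX ▸ L)⟩

theorem ChordLabelling.eq_bot_of_three_lt_ncard [NeZero n] (L : ChordLabelling A X n)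
    (hL : ∀ s t, s ≠ t → L.mirror s ⊓ L.mirror t ≤ X) (hX : IsAtom X) (hn : n ≤ 3)
    {Y : Submodule ℝ V} (hY : 3 < (A.localization Y).hyperplanes.ncard) : Y = ⊥ := by
  refine (hX.le_iff.1 (L.le_of_three_lt_ncard hL hY)).resolve_right fun h => ?_
  rw [h, L.ncard_localization] at hY
  lia

theorem exists_injective_range_eq_of_ncard_eq {α : Type*} [NeZero n] {S : Set α}
    (hS : S.ncard = n) : ∃ f : ZMod n → α, Function.Injective f ∧ Set.range f = S := by
  have : Finite S := Set.finite_of_ncard_ne_zero (hS ▸ NeZero.ne n)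
  let f : ZMod n ≃ S := (ZMod.finEquiv n).symm.toEquiv.trans (Finite.equivFinOfCardEq hS).symm
  exact ⟨fun i => f i, Subtype.val_injective.comp f.injective,
    (f.surjective.range_comp Subtype.val).trans Subtype.range_coe⟩

theorem not_inf_le_of_inf_le (hX : IsAtom X) (hXc : ¬IsCoatom X)
    (hfew : ∀ Y ∈ A.flats, 3 < (A.localization Y).hyperplanes.ncard → Y ≤ X)
    {H K K' M : Submodule ℝ V} (hH : H ∈ A.hyperplanes) (hK : K ∈ A.hyperplanes)
    (hK' : K' ∈ A.hyperplanes) (hM : M ∈ A.hyperplanes) (hXH : ¬X ≤ H) (hXK : ¬X ≤ K)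
    (hXK' : ¬X ≤ K') (hXM : X ≤ M) (hHK : H ≠ K) (hHK' : H ≠ K') (hKK' : K ≠ K')
    (hle : H ⊓ K ≤ M) : ¬H ⊓ K' ≤ M := fun hle' => by
  have hc {Q : Submodule ℝ V} (hQ : Q ∈ A.hyperplanes) : IsCoatom Q := A.isCoatom_of_mem Q hQ
  have ne_M {Q : Submodule ℝ V} (hXQ : ¬X ≤ Q) : Q ≠ M := fun h => hXQ (h ▸ hXM)
  have hHM := ne_M hXH
  have hleK : H ⊓ M ≤ K :=
    (inf_eq_inf_of_inf_le (hc hH) (hc hK) (hc hM) hHK hHM hle).ge.trans inf_le_right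
  have hleK' : H ⊓ M ≤ K' :=
    (inf_eq_inf_of_inf_le (hc hH) (hc hK') (hc hM) hHK' hHM hle').ge.trans inf_le_right
  have hfour : 3 < (A.localization (H ⊓ M)).hyperplanes.ncard := calc
    3 < ({M, H, K, K'} : Set (Submodule ℝ V)).ncard := by
      rw [Set.ncard_insert_of_notMem, Set.ncard_eq_three.2 ⟨H, K, K', hHK, hHK', hKK', rfl⟩]
      · exact Nat.lt_succ_self 3
      · rintro (h | h | h)
        exacts [hHM h.symm, ne_M hXK h.symm, ne_M hXK' h.symm]
    _ ≤ _ := by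
      refine Set.ncard_le_ncard ?_ (A.localization _).finite_hyperplanes
      rintro _ (rfl | rfl | rfl | rfl)
      exacts [⟨hM, inf_le_right⟩, ⟨hH, inf_le_left⟩, ⟨hK, hleK⟩, ⟨hK', hleK'⟩]
  have hflat := inf_mem_flats (mem_flats_of_mem_hyperplanes hH) (mem_flats_of_mem_hyperplanes hM)
  have hbot : H ⊓ M = ⊥ := le_bot_iff.1 <|
    (hX.not_le_iff_disjoint.1 hXH).symm inf_le_left (hfew _ hflat hfour)
  have hMatom : IsAtom M := by
    rw [← bot_covBy_iff, ← hbot, inf_comm]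
    exact inf_covBy_left_of_isCoatom (hc hM) (hc hH) hHM.symm
  exact hXc (((hMatom.le_iff_eq hX.1).1 hXM).symm ▸ hc hM)

theorem IsModular.nonempty_chordLabelling_three (hmod : A.IsModular X) (hX : IsAtom X)
    (hXc : ¬IsCoatom X) (hloc : (A.localization X).hyperplanes.ncard = 3)
    (hA : A.hyperplanes.ncard = 6)
    (hfew : ∀ Y ∈ A.flats, 3 < (A.localization Y).hyperplanes.ncard → Y ≤ X) :
    Nonempty (ChordLabelling A X 3) := by
  have hsub : (A.localization X).hyperplanes ⊆ A.hyperplanes := fun H hH => hH.1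
  have hcard : (A.hyperplanes \ (A.localization X).hyperplanes).ncard = 3 := by
    rw [Set.ncard_sdiff hsub (A.localization X).finite_hyperplanes, hA, hloc]
  obtain ⟨side, side_injective, range_side⟩ := exists_injective_range_eq_of_ncard_eq hcard
  have side_mem (i : ZMod 3) : side i ∈ A.hyperplanes \ (A.localization X).hyperplanes :=
    range_side ▸ Set.mem_range_self i
  have not_le_side (i : ZMod 3) : ¬X ≤ side i := fun h => (side_mem i).2 ⟨(side_mem i).1, h⟩
  -- `1 - s` and `2 - s` are the two distinct elements of `ℤ/3` with sum `s`
  let mirror (s : ZMod 3) : Submodule ℝ V := X ⊔ side (1 - s) ⊓ side (2 - s)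
  have mirror_mem (s : ZMod 3) : mirror s ∈ (A.localization X).hyperplanes :=
    hmod.sup_inf_mem_localization hX (side_mem _).1 (side_mem _).1
      (side_injective.ne (by revert s; decide)) (not_le_side _)
  have side_inf_side_le (i j : ZMod 3) (hij : i ≠ j) :
      side i ⊓ side j ≤ mirror (i + j) := by
    have hpair : (i = 1 - (i + j) ∧ j = 2 - (i + j)) ∨ (j = 1 - (i + j) ∧ i = 2 - (i + j)) := by
      revert i j; decide
    refine le_sup_of_le_right ?_
    rcases hpair with ⟨hi, hj⟩ | ⟨hj, hi⟩
    · rw [← hi, ← hj]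
    · rw [← hi, ← hj, inf_comm]
  have mirror_injective : Function.Injective mirror := fun s t hst => by
    by_contra hne
    obtain ⟨c, a, b, hca, hcb, hab, rfl, rfl⟩ :
        ∃ c a b : ZMod 3, c ≠ a ∧ c ≠ b ∧ a ≠ b ∧ c + a = s ∧ c + b = t := by
      clear hst; revert s t; decide
    exact not_inf_le_of_inf_le hX hXc hfew (side_mem c).1 (side_mem a).1 (side_mem b).1
      (mirror_mem (c + a)).1 (not_le_side c) (not_le_side a) (not_le_side b) (mirror_mem _).2
      (side_injective.ne hca) (side_injective.ne hcb) (side_injective.ne hab)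
      (side_inf_side_le c a hca) (hst ▸ side_inf_side_le c b hcb)
  have range_mirror : Set.range mirror = (A.localization X).hyperplanes := by
    refine Set.eq_of_subset_of_ncard_le (Set.range_subset_iff.2 mirror_mem) ?_
      (A.localization X).finite_hyperplanes
    rw [hloc, Set.ncard_range_of_injective mirror_injective, Nat.card_zmod]
  exact ⟨mirror, side, mirror_injective, fun s => (mirror_mem s).2, not_le_side,
    by rw [range_mirror, range_side, Set.union_sdiff_cancel hsub], side_inf_side_le⟩

theorem IsModular.nonempty_chordLabelling (hmod : A.IsModular X) (hX : IsAtom X)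
    (hXc : ¬IsCoatom X) (hn : 3 ≤ n) (hloc : (A.localization X).hyperplanes.ncard = n)
    (hA : A.LatticeEquiv (A2n n)) : Nonempty (ChordLabelling A X n) := by
  have : NeZero n := ⟨by lia⟩
  obtain ⟨e⟩ := hA.nonempty_flats_orderIso
  have hL (s t : ZMod n) (hst : s ≠ t) := labellingA2n_mirror_inf_mirror_le hst
  obtain hn | rfl := hn.lt_or_eq
  · exact (labellingA2n n).nonempty_of_orderIso hL (axis_mem_flats (by lia)) e hmod.1 hloc hn
  -- The axis is not the only triple point of `A(6,1)`, so `e` need not map `X` to it.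
  · refine hmod.nonempty_chordLabelling_three hX hXc hloc ?_ fun Y hY hcard => ?_
    · rw [← ncard_hyperplanes_eq e, (labellingA2n 3).ncard_hyperplanes]
    · let Y' : A.flats := ⟨Y, hY⟩
      let X' : A.flats := ⟨X, hmod.1⟩
      rw [← ncard_localization_apply e Y'] at hcard
      have hbot := (labellingA2n 3).eq_bot_of_three_lt_ncard hL isAtom_axis le_rfl hcard
      have hle : e Y' ≤ e X' :=
        show (e Y' : Submodule ℝ (Fin 3 → ℝ)) ≤ e X' from hbot.trans_le bot_le
      exact e.le_iff_le.1 hle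

end Existence

section Realization

open Module

variable {V : Type*} [AddCommGroup V] [Module ℝ V] {A : Arrangement V} {X : Submodule ℝ V} {n : ℕ}

theorem exists_dual_ker_eq_apply_eq_one {H : Submodule ℝ V} (hH : IsCoatom H) {x : V}
    (hx : x ∉ H) : ∃ f : Dual ℝ V, LinearMap.ker f = H ∧ f x = 1 := by
  obtain ⟨f, hf0, hf⟩ := Submodule.exists_le_ker_of_lt_top H hH.lt_top
  have hker : LinearMap.ker f = H :=
    (hH.le_iff.1 hf).resolve_left fun h => hf0 (LinearMap.ker_eq_top.1 h)
  have hfx : f x ≠ 0 := fun h => hx (hker ▸ LinearMap.mem_ker.2 h)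
  refine ⟨(f x)⁻¹ • f, ?_, inv_mul_cancel₀ hfx⟩
  rw [LinearMap.ker_smul _ _ (inv_ne_zero hfx), hker]

theorem isCoatom_ker_of_ne_zero {f : Dual ℝ V} (hf : f ≠ 0) : IsCoatom (LinearMap.ker f) :=
  LinearMap.isCoatom_ker_of_surjective (LinearMap.surjective hf)

theorem exists_eq_smul_of_ker_le {f g : Dual ℝ V} (h : LinearMap.ker g ≤ LinearMap.ker f) :
    ∃ t : ℝ, f = t • g := by
  have hmem := mem_span_of_iInf_ker_le_ker (L := fun _ : Unit => g) (K := f) (by simpa using h)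
  rw [Set.range_const, Submodule.mem_span_singleton] at hmem
  exact hmem.imp fun _ => Eq.symm

theorem linearIndependent_pair_of_ker_ne {f g : Dual ℝ V} (hf : f ≠ 0) (hg : g ≠ 0)
    (h : LinearMap.ker f ≠ LinearMap.ker g) : LinearIndependent ℝ ![f, g] := by
  refine (LinearIndependent.pair_iff' hf).2 fun t ht => h ?_
  have ht0 : t ≠ 0 := fun h0 => hg (by rw [← ht, h0, zero_smul])
  rw [← ht, LinearMap.ker_smul _ _ ht0]

theorem ker_sub_eq_of_ker_inf_ker_le {x : V} {f g : Dual ℝ V} {M : Submodule ℝ V} (hf : f x = 1)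
    (hg : g x = 1) (hfg : f ≠ g) (hM : M ≠ ⊤) (hx : x ∈ M)
    (hle : LinearMap.ker f ⊓ LinearMap.ker g ≤ M) : LinearMap.ker (f - g) = M := by
  refine (((isCoatom_ker_of_ne_zero (sub_ne_zero.2 hfg)).le_iff_eq hM).1 fun v hv => ?_).symm
  have hfv : f v = g v := sub_eq_zero.1 hv
  have hmem : v - f v • x ∈ LinearMap.ker f ⊓ LinearMap.ker g := by
    constructor
    · simp [hf]
    · simp [hg, hfv]
  simpa only [sub_add_cancel] using M.add_mem (hle hmem) (M.smul_mem (f v) hx)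

theorem notMem_of_not_le (hX : IsAtom X) {x : V} (hx : x ∈ X) (hx0 : x ≠ 0) {H : Submodule ℝ V}
    (hXH : ¬X ≤ H) : x ∉ H := fun hxH =>
  hx0 (Submodule.disjoint_def.1 (hX.not_le_iff_disjoint.1 hXH) x hx hxH)

theorem exists_ne_add_eq (hn : 3 ≤ n) (s : ZMod n) : ∃ j k, j ≠ k ∧ j + k = s := by
  by_cases h : s + 1 = -1
  · exact ⟨s + 2, -2, fun h' => zmod_two_ne_zero hn (by linear_combination h' - h), by ring⟩
  · exact ⟨s + 1, -1, h, by ring⟩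

/-- A realization of the `side i` of a labelling as the kernels of the vertices
`center + plane (char i)` of an affinely regular `n`-gon in the affine plane of the functionals
taking the value `1` at a point `base` of `X`. -/
structure RegularRealization (L : ChordLabelling A X n) where
  base : V
  base_mem : base ∈ X
  char : AddChar (ZMod n) ℂ
  center : Dual ℝ V
  plane : ℂ →ₗ[ℝ] Dual ℝ V
  char_injective : Function.Injective char
  plane_injective : Function.Injective plane
  vertex_apply_base : ∀ i, (center + plane (char i)) base = 1
  ker_vertex : ∀ i, LinearMap.ker (center + plane (char i)) = L.side i

theorem ChordLabelling.nonempty_regularRealization (L : ChordLabelling A X n) (hX : IsAtom X)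
    (hn : 3 ≤ n) : Nonempty (RegularRealization L) := by
  have : Fact (1 < n) := ⟨by lia⟩
  obtain ⟨x, hx, hx0⟩ := Submodule.exists_mem_ne_zero_of_ne_bot hX.1
  choose p hker hpx using fun i => exists_dual_ker_eq_apply_eq_one (L.isCoatom_side i)
    (notMem_of_not_le hX hx hx0 (L.not_le_side i))
  have hinj : Function.Injective p := fun i j hij =>
    L.side_injective (by rw [← hker, ← hker, hij])
  have ker_sub {i j : ZMod n} (hij : i ≠ j) : LinearMap.ker (p i - p j) = L.mirror (i + j) :=
    ker_sub_eq_of_ker_inf_ker_le (hpx i) (hpx j) (hinj.ne hij) (L.isCoatom_mirror _).1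
      (L.le_mirror _ hx) (by rw [hker, hker]; exact L.side_inf_side_le i j hij)
  have succ_ne (i : ZMod n) : i + 1 ≠ i := fun h => one_ne_zero (add_eq_left.1 h)
  have succ_succ_ne (i : ZMod n) : i + 2 ≠ i + 1 := fun h =>
    succ_ne (i + 1) (by linear_combination h)
  obtain ⟨ψ, c, G, hψ, hG, hp⟩ := exists_addChar_of_parallel (p := p)
    (fun i j k l hkl hsum => by
      by_cases hij : i = j
      · exact ⟨0, by rw [hij, sub_self, zero_smul]⟩
      · exact exists_eq_smul_of_ker_le (by rw [ker_sub hij, ker_sub hkl, hsum]))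
    (fun i => by
      refine linearIndependent_pair_of_ker_ne (sub_ne_zero.2 (hinj.ne (succ_ne i)))
        (sub_ne_zero.2 (hinj.ne (succ_succ_ne i))) fun h => zmod_two_ne_zero hn ?_
      rw [ker_sub (succ_ne i), ker_sub (succ_succ_ne i)] at h
      linear_combination -L.mirror_injective h) hn hinj
  exact ⟨x, hx, ψ, c, G, hψ, hG, fun i => hp i ▸ hpx i, fun i => hp i ▸ hker i⟩

namespace RegularRealization

variable {L : ChordLabelling A X n} (R : RegularRealization L)

/-- The functional with kernel `side i`. -/
noncomputable def vertex (i : ZMod n) : Dual ℝ V := R.center + R.plane (R.char i)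

theorem vertex_sub_vertex (i j : ZMod n) :
    R.vertex i - R.vertex j = R.plane (R.char i - R.char j) := by
  rw [vertex, vertex, add_sub_add_left_eq_sub, map_sub]

theorem vertex_injective : Function.Injective R.vertex := fun _ _ h =>
  R.char_injective (R.plane_injective (add_left_cancel h))

theorem ker_sub_vertex {q : Dual ℝ V} (hq : q R.base = 1) {i s : ZMod n} (hqi : q ≠ R.vertex i)
    (hle : LinearMap.ker q ⊓ L.side i ≤ L.mirror s) :
    LinearMap.ker (q - R.vertex i) = L.mirror s :=
  ker_sub_eq_of_ker_inf_ker_le hq (R.vertex_apply_base i) hqi (L.isCoatom_mirror s).1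
    (L.le_mirror s R.base_mem) ((R.ker_vertex i).symm ▸ hle)

theorem ker_vertex_sub_vertex {i j : ZMod n} (hij : i ≠ j) :
    LinearMap.ker (R.vertex i - R.vertex j) = L.mirror (i + j) :=
  R.ker_sub_vertex (R.vertex_apply_base i) (R.vertex_injective.ne hij)
    ((R.ker_vertex i).symm ▸ L.side_inf_side_le i j hij)

section ExtraPoint

variable {q : Dual ℝ V} {f : ZMod n → ZMod n}

theorem apply_sub_eq_of_ker_sub_vertex (hf : ∀ i, LinearMap.ker (q - R.vertex i) = L.mirror (f i))
    (i : ZMod n) : f (f i - i) = f i := by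
  by_cases hi : i = f i - i
  · rw [← hi]
  have hchord := R.ker_vertex_sub_vertex hi
  rw [add_sub_cancel] at hchord
  have hle : L.mirror (f i) ≤ L.mirror (f (f i - i)) := fun v hv => by
    have hq : v ∈ LinearMap.ker (q - R.vertex i) := hf i ▸ hv
    rw [← hf, ← sub_add_sub_cancel q (R.vertex i)]
    rw [LinearMap.mem_ker, LinearMap.add_apply, LinearMap.mem_ker.1 hq,
      LinearMap.mem_ker.1 (hchord ▸ hv : v ∈ LinearMap.ker (R.vertex i - R.vertex _)), add_zero]
  exact L.mirror_injective (((L.isCoatom_mirror _).le_iff_eq (L.isCoatom_mirror _).1).1 hle)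

theorem exists_sub_vertex_eq_smul (hn : 3 ≤ n)
    (hf : ∀ i, LinearMap.ker (q - R.vertex i) = L.mirror (f i)) (i : ZMod n) :
    ∃ (t : ℝ) (j k : ZMod n), j + k = f i ∧
      q - R.vertex i = R.plane (t * (R.char j - R.char k)) := by
  obtain ⟨j, k, hjk, hsum⟩ := exists_ne_add_eq hn (f i)
  obtain ⟨t, ht⟩ := exists_eq_smul_of_ker_le (f := q - R.vertex i) (g := R.vertex j - R.vertex k)
    (by rw [R.ker_vertex_sub_vertex hjk, hsum, hf])
  refine ⟨t, j, k, hsum, ?_⟩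
  rw [ht, vertex_sub_vertex, ← map_smul, Complex.real_smul]

theorem eq_center_and_even (hn : 3 ≤ n)
    (hf : ∀ i, LinearMap.ker (q - R.vertex i) = L.mirror (f i)) : q = R.center ∧ Even n := by
  have : NeZero n := ⟨by lia⟩
  have hdir := R.exists_sub_vertex_eq_smul hn hf
  obtain ⟨w, hw⟩ : ∃ w, q = R.center + R.plane w := by
    obtain ⟨t, j, k, -, ht⟩ := hdir 0
    refine ⟨R.char 0 + t * (R.char j - R.char k), ?_⟩
    rw [map_add, ← ht, ← add_assoc, ← vertex, add_sub_cancel]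
  have hinv : Function.Involutive fun i => f i - i := fun i => by
    simp only [R.apply_sub_eq_of_ker_sub_vertex hf, sub_sub_cancel]
  obtain ⟨hw0, heven⟩ := eq_zero_and_even_of_perm hn R.char_injective (σ := hinv.toPerm) (w := w)
    fun i => by
      obtain ⟨t, j, k, hsum, ht⟩ := hdir i
      rw [hw, vertex, add_sub_add_left_eq_sub, ← map_sub] at ht
      exact add_mul_conj_eq_of_sub_eq (hsum.trans (add_sub_cancel i (f i)).symm)
        (R.plane_injective ht)
  exact ⟨by rw [hw, hw0, map_zero, add_zero], heven⟩

end ExtraPoint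

end RegularRealization

end Realization

section Coordinates

open Module

variable {n : ℕ} [NeZero n]

/-- The realization of `A(2n,1)` by the regular `n`-gon with vertices
`exp (πi / n) * exp (2πik / n)`, in which `(0,0,1)^⊥` is the center. -/
noncomputable def realizationA2n (n : ℕ) [NeZero n] : RegularRealization (labellingA2n n) where
  base := Pi.single 2 1
  base_mem := Complex.ext (by simp [planar]) (by simp [planar])
  char := ZMod.stdAddChar
  center := LinearMap.proj 2
  plane :=
    { toFun z := (halfRoot n * z).re • LinearMap.proj 0 + (halfRoot n * z).im • LinearMap.proj 1
      map_add' z w := by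
        simp only [mul_add, Complex.add_re, Complex.add_im, add_smul]
        abel
      map_smul' t z := by
        simp only [mul_smul_comm, Complex.smul_re, Complex.smul_im, smul_assoc, smul_add,
          RingHom.id_apply] }
  char_injective := ZMod.injective_stdAddChar
  plane_injective := (injective_iff_map_eq_zero _).2 fun z hz => by
    have hre : (halfRoot n * z).re = 0 := by simpa using LinearMap.congr_fun hz (Pi.single 0 1)
    have him : (halfRoot n * z).im = 0 := by simpa using LinearMap.congr_fun hz (Pi.single 1 1)
    exact (mul_eq_zero.1 (Complex.ext hre him)).resolve_left (halfRoot_ne_zero n)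
  vertex_apply_base i := by simp
  ker_vertex i := by
    have hroot : halfRoot n * ZMod.stdAddChar i =
        ⟨cosN n (2 * i.val + 1), sinN n (2 * i.val + 1)⟩ := by
      rw [← halfRoot_pow, halfRoot_pow_two_mul_add_one, ZMod.natCast_zmod_val]
    ext v
    simp only [labellingA2n, mem_perp, LinearMap.mem_ker, LinearMap.coe_mk, AddHom.coe_mk, hroot]
    simp [add_comm]

theorem exists_stdAddChar_eq (ψ : AddChar (ZMod n) ℂ) (i : ZMod n) :
    ∃ a : ZMod n, ZMod.stdAddChar a = ψ i := by
  have hpow : ψ i ^ n = 1 := by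
    rw [← AddChar.map_nsmul_eq_pow, nsmul_eq_mul, ZMod.natCast_self, zero_mul,
      AddChar.map_zero_eq_one]
  have hprim : IsPrimitiveRoot (ZMod.stdAddChar (1 : ZMod n)) n := by
    have h := Complex.isPrimitiveRoot_exp n (NeZero.ne n)
    have h1 := ZMod.stdAddChar_coe (N := n) 1
    rw [Int.cast_one, Int.cast_one, mul_one] at h1
    rwa [h1]
  obtain ⟨k, -, hk⟩ := hprim.eq_pow_of_pow_eq_one hpow
  exact ⟨k • 1, by rw [AddChar.map_nsmul_eq_pow, hk]⟩

namespace RegularRealization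

variable {V : Type*} [AddCommGroup V] [Module ℝ V] {A : Arrangement V} {X : Submodule ℝ V}
  {L : ChordLabelling A X n} (R : RegularRealization L)

/-- The linear map to `ℝ³` pulling `realizationA2n n` back to `R`. -/
noncomputable def coordMap : V →ₗ[ℝ] (Fin 3 → ℝ) :=
  LinearMap.pi ![R.plane (halfRoot n)⁻¹, R.plane ((halfRoot n)⁻¹ * Complex.I), R.center]

theorem center_comp_coordMap : (realizationA2n n).center ∘ₗ R.coordMap = R.center := rfl

theorem plane_comp_coordMap (z : ℂ) : (realizationA2n n).plane z ∘ₗ R.coordMap = R.plane z := by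
  have hz : z = (halfRoot n * z).re • (halfRoot n)⁻¹ +
      (halfRoot n * z).im • ((halfRoot n)⁻¹ * Complex.I) := by
    apply mul_left_cancel₀ (halfRoot_ne_zero n)
    rw [mul_add, mul_smul_comm, mul_smul_comm, mul_inv_cancel_left₀ (halfRoot_ne_zero n),
      mul_inv_cancel₀ (halfRoot_ne_zero n), Complex.real_smul, Complex.real_smul, mul_one,
      Complex.re_add_im]
  conv_rhs => rw [hz, map_add, map_smul, map_smul]
  rfl

section

variable {i j a b : ZMod n}

theorem vertex_comp_coordMap (ha : ZMod.stdAddChar a = R.char i) :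
    (realizationA2n n).vertex a ∘ₗ R.coordMap = R.vertex i := by
  rw [vertex, LinearMap.add_comp, center_comp_coordMap, plane_comp_coordMap, vertex, ← ha]
  rfl

theorem comap_coordMap_side (ha : ZMod.stdAddChar a = R.char i) :
    ((labellingA2n n).side a).comap R.coordMap = L.side i := by
  rw [← (realizationA2n n).ker_vertex, ← R.ker_vertex, ← LinearMap.ker_comp]
  exact congrArg LinearMap.ker (R.vertex_comp_coordMap ha)

theorem comap_coordMap_mirror (hij : i ≠ j) (ha : ZMod.stdAddChar a = R.char i)
    (hb : ZMod.stdAddChar b = R.char j) :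
    ((labellingA2n n).mirror (a + b)).comap R.coordMap = L.mirror (i + j) := by
  have hab : a ≠ b := fun h => hij (R.char_injective (ha.symm.trans ((congrArg _ h).trans hb)))
  rw [← (realizationA2n n).ker_vertex_sub_vertex hab, ← R.ker_vertex_sub_vertex hij,
    ← LinearMap.ker_comp, LinearMap.sub_comp, R.vertex_comp_coordMap ha, R.vertex_comp_coordMap hb]

end

omit [NeZero n] in
theorem comap_coordMap_perp_center :
    (perp ![0, 0, 1]).comap R.coordMap = LinearMap.ker R.center := by
  ext v
  simp [mem_perp, coordMap]

theorem hyperplanes_eq_comap_coordMap (hn : 3 ≤ n) :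
    A.hyperplanes = Submodule.comap R.coordMap '' (A2n n).hyperplanes := by
  refine Set.eq_of_subset_of_ncard_le ?_ ?_ ((A2n n).finite_hyperplanes.image _)
  · rw [L.hyperplanes_eq]
    rintro _ (⟨s, rfl⟩ | ⟨i, rfl⟩)
    · obtain ⟨i, j, hij, rfl⟩ := exists_ne_add_eq hn s
      obtain ⟨a, ha⟩ := exists_stdAddChar_eq R.char i
      obtain ⟨b, hb⟩ := exists_stdAddChar_eq R.char j
      exact ⟨_, (labellingA2n n).mirror_mem _, R.comap_coordMap_mirror hij ha hb⟩
    · obtain ⟨a, ha⟩ := exists_stdAddChar_eq R.char i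
      exact ⟨_, (labellingA2n n).side_mem a, R.comap_coordMap_side ha⟩
  · rw [L.ncard_hyperplanes, ← (labellingA2n n).ncard_hyperplanes]
    exact Set.ncard_image_le (A2n n).finite_hyperplanes

theorem coordMap_injective (hn : 3 ≤ n) (hX : IsAtom X) (hXA : X ∈ A.flats) :
    Function.Injective R.coordMap := by
  have hle {H : Submodule ℝ V} (hH : H ∈ A.hyperplanes) : LinearMap.ker R.coordMap ≤ H := by
    rw [R.hyperplanes_eq_comap_coordMap hn] at hH
    obtain ⟨K, -, rfl⟩ := hH
    exact LinearMap.ker_le_comap _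
  have hker : LinearMap.ker R.coordMap ≤ X := by
    refine le_of_le_of_eq (le_sInf fun H hH => ?_) (sInf_localization hXA)
    exact hle hH.1
  rw [← LinearMap.ker_eq_bot]
  exact (hX.le_iff.1 hker).resolve_right fun h =>
    L.not_le_side 0 (h.ge.trans (hle (L.side_mem 0)))

/-- The isomorphism with `ℝ³` given by `coordMap`. -/
noncomputable def coordEquiv (hn : 3 ≤ n) (hV : finrank ℝ V = 3) (hX : IsAtom X)
    (hXA : X ∈ A.flats) : V ≃ₗ[ℝ] (Fin 3 → ℝ) :=
  have : FiniteDimensional ℝ V := .of_finrank_pos (by lia)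
  .ofInjectiveOfFinrankEq R.coordMap (R.coordMap_injective hn hX hXA) (by simp [hV])

theorem latticeEquiv_A4mAddOne {A' : Arrangement V} (hn : 3 ≤ n) (heven : Even n)
    (hV : finrank ℝ V = 3) (hX : IsAtom X) (hXA : X ∈ A.flats)
    (hA' : A'.hyperplanes = insert (LinearMap.ker R.center) A.hyperplanes) :
    A'.LatticeEquiv (A4mAddOne (n / 2)) := by
  refine latticeEquiv_of_linearEquiv (R.coordEquiv hn hV hX hXA) ?_
  change _ = Submodule.comap R.coordMap '' insert _ (A2n (2 * (n / 2))).hyperplanes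
  rw [Nat.two_mul_div_two_of_even heven, Set.image_insert_eq, ← R.hyperplanes_eq_comap_coordMap hn,
    comap_coordMap_perp_center, hA']

end RegularRealization

end Coordinates

section ExtraHyperplane

variable {V : Type*} [AddCommGroup V] [Module ℝ V] {A B : Arrangement V} {X J : Submodule ℝ V}
  {n : ℕ} {L : ChordLabelling B X n}

theorem RegularRealization.eq_ker_center_and_even (R : RegularRealization L) (hn : 3 ≤ n)
    (hX : IsAtom X) (hmod : A.IsModular X) (hBA : B.hyperplanes ⊆ A.hyperplanes)
    (hBX : A.localization X = B.localization X) (hJ : J ∈ A.hyperplanes \ B.hyperplanes) :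
    J = LinearMap.ker R.center ∧ Even n := by
  have hXJ : ¬X ≤ J := fun h => hJ.2 (hBX ▸ ⟨hJ.1, h⟩ : J ∈ (B.localization X).hyperplanes).1
  have hbase : R.base ≠ 0 := fun h => by
    simpa only [h, map_zero, zero_ne_one] using R.vertex_apply_base 0
  obtain ⟨q, rfl, hq⟩ := exists_dual_ker_eq_apply_eq_one (A.isCoatom_of_mem J hJ.1)
    (notMem_of_not_le hX R.base_mem hbase hXJ)
  have hne (i : ZMod n) : q ≠ R.vertex i := fun h =>
    hJ.2 (by rw [h]; exact (R.ker_vertex i).symm ▸ L.side_mem i)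
  have hchord (i : ZMod n) : ∃ s, LinearMap.ker (q - R.vertex i) = L.mirror s := by
    have hside : LinearMap.ker q ≠ L.side i := fun h => hJ.2 (h ▸ L.side_mem i)
    have hmem := hmod.sup_inf_mem_localization hX hJ.1 (hBA (L.side_mem i)) hside hXJ
    rw [hBX, ← L.range_mirror] at hmem
    obtain ⟨s, hs⟩ := hmem
    exact ⟨s, R.ker_sub_vertex hq (hne i) (hs ▸ le_sup_right)⟩
  choose f hf using hchord
  obtain ⟨rfl, heven⟩ := R.eq_center_and_even hn hf
  exact ⟨rfl, heven⟩

end ExtraHyperplane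

end Arrangement

theorem mainTheorem9_general {V : Type*} [AddCommGroup V] [Module ℝ V]
    (hV : Module.finrank ℝ V = 3)
    (A : Arrangement V) (hirr : A.IsIrreducible)
    (X : Submodule ℝ V) (hX : X ∈ A.flatsOfRank 2) (hmod : A.IsModular X)
    (n : ℕ) (hn : n = (A.localization X).hyperplanes.ncard)
    (B : Arrangement V) (hBA : B.hyperplanes ⊆ A.hyperplanes)
    (hBX : A.localization X = B.localization X)
    (hB : B.LatticeEquiv (Arrangement.A2n n)) :
    (A.hyperplanes \ B.hyperplanes).ncard ≤ 1 ∧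
    (∀ J : Submodule ℝ V, J ∉ B.hyperplanes → A.hyperplanes = insert J B.hyperplanes →
      Even n ∧ A.LatticeEquiv (Arrangement.A4mAddOne (n / 2))) := by
  obtain ⟨hatom, htop, hcoatom⟩ :=
    Arrangement.isAtom_and_not_isCoatom_of_finrank_quotient_eq_two hV hX.2
  have hn3 : 3 ≤ n := hn ▸ hmod.three_le_ncard_localization hirr hatom htop hcoatom
  have : NeZero n := ⟨by lia⟩
  have hmodB : B.IsModular X := hmod.of_localization_eq hBA hBX
  obtain ⟨L⟩ := hmodB.nonempty_chordLabelling hatom hcoatom hn3 (hBX ▸ hn.symm) hB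
  obtain ⟨R⟩ := L.nonempty_regularRealization hatom hn3
  have hextra {J : Submodule ℝ V} (hJ : J ∈ A.hyperplanes \ B.hyperplanes) :
      J = LinearMap.ker R.center ∧ Even n :=
    R.eq_ker_center_and_even hn3 hatom hmod hBA hBX hJ
  refine ⟨?_, fun J hJ hA => ?_⟩
  · refine (Set.ncard_le_one_iff (A.finite_hyperplanes.subset Set.sdiff_subset)).2 ?_
    exact fun hJ hK => (hextra hJ).1.trans (hextra hK).1.symm
  · obtain ⟨rfl, heven⟩ := hextra ⟨hA ▸ Set.mem_insert J _, hJ⟩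
    exact ⟨heven, R.latticeEquiv_A4mAddOne hn3 heven hV hatom hmodB.1 hA⟩

theorem mainTheorem9 {V : Type*} [NormedAddCommGroup V] [NormedSpace ℝ V]
    (hV : Module.finrank ℝ V = 3)
    (A : Arrangement V) (hirr : A.IsIrreducible) (hss : A.IsSupersolvable)
    (hsimp : A.IsSimplicial)
    (X : Submodule ℝ V) (hX : X ∈ A.flatsOfRank 2) (hmod : A.IsModular X)
    (n : ℕ) (hn : n = (A.localization X).hyperplanes.ncard)
    (B : Arrangement V) (hBA : B.hyperplanes ⊆ A.hyperplanes)
    (hBX : A.localization X = B.localization X)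
    (hB : B.LatticeEquiv (Arrangement.A2n n)) :
    (A.hyperplanes \ B.hyperplanes).ncard ≤ 1 ∧
    (∀ J : Submodule ℝ V, J ∉ B.hyperplanes → A.hyperplanes = insert J B.hyperplanes →
      Even n ∧ A.LatticeEquiv (Arrangement.A4mAddOne (n / 2))) :=
  mainTheorem9_general hV A hirr X hX hmod n hn B hBA hBX hB
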